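/- Let $n,p$ be fixed natural numbers and $\theta_0=(g_1^0,\dots,g_n^0)^T\in\mathbb R^n$. For $t=1,2,\dots$ let $$y(t)=\sum_{i=1}^n g_i^0\,u(t-i)+v(t),\qquad u(t)=\sum_{k=0}^\infty h(k)e(t-k)\quad(t\in\mathbb Z),\qquad \sum_{k=0}^\infty|h(k)|<\infty .$$ Here $\{e(t)\}_{t\in\mathbb Z}$ are i.i.d. with mean zero, variance $\sigma_e^2>0$, finite moments of order $4+\delta$ for some $\delta>0$ and $\mathbb E[e(t)^4]=c\,\sigma_e^4$ for some $c>0$; $\{v(t)\}_{t\ge 1}$ are i.i.d. with mean zero, variance $\sigma^2>0$ and finite moments of order $4+\delta$ for some $\delta>0$; and the process $\{e(t)\}_{t\in\mathbb Z}$ is independent of the process $\{v(t)\}_{t\ge 1}$. Let $\Sigma=\mathrm{Cov}\big((u(0),\dots,u(n-1))^T\big)$ and assume $\Sigma\succ0$. For each $N$ let $Y=(y(1),\dots,y(N))^T$ and let $\Phi\in\mathbb R^{N\times n}$ be the matrix whose $t$-th row is $(u(t-1),\dots,u(t-n))$. Assume that, almost surely, $\mathrm{rank}(\Phi)=n$ for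 all sufficiently large $N$. Put $$\hat\theta^{LS}=(\Phi^T\Phi)^{-1}\Phi^TY,\qquad \widehat{\sigma^2}=\frac{\|Y-\Phi\hat\theta^{LS}\|_2^2}{N-n}.$$ Let $\Omega\subset\mathbb R^p$ be a compact set not depending on $N$, and for $\eta\in\Omega$ let $P(\eta)\in\mathbb R^{n\times n}$ be positive definite and twice continuously differentiable in $\eta$ on $\Omega$. Let $\hat Q(\eta)=\Phi P(\eta)\Phi^T+\widehat{\sigma^2}I_N$ and let the empirical Bayes estimator $\hat\eta_{EB}$ be an $\Omega$-valued random variable such that, almost surely, for all sufficiently large $N$, $$\hat\eta_{EB}\in\operatorname*{arg\,min}_{\eta\in\Omega}\ \big\{Y^T\hat Q(\eta)^{-1}Y+\log\det\hat Q(\eta)\big\}$$ and $\hat\eta_{EB}$ is an interior point of $\Omega$. Assume also that the set $\eta_b^*=\operatorname*{arg\,min}_{\eta\in\Omega}\{\theta_0^TP(\eta)^{-1}\theta_0+\log\det P(\eta)\}$ contains an interior point of $\Omega$ and consists of isolated points. Let $$\hat\theta^{R}(\hat\eta_{EB})=P(\hat\eta_{EB})\Phi^T\hat Q(\hat\eta_{EB})^{-1}Y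 .$$ Then, as $N\to\infty$, $$\sqrt N\big(\hat\theta^{R}(\hat\eta_{EB})-\theta_0\big)\xrightarrow{d}\mathcal N(0,\sigma^2\Sigma^{-1}),$$ and the ordinary least squares estimator has the same limit, $\sqrt N(\hat\theta^{LS}-\theta_0)\xrightarrow{d}\mathcal N(0,\sigma^2\Sigma^{-1})$. -/

import Mathlib

open MeasureTheory ProbabilityTheory Filter Topology Matrix

noncomputable section

namespace RegFIR

/-- The input `u(t) = ∑_{k ≥ 0} h(k) e(t - k)`: the white noise `e` passed through the filter
with impulse response `h`. For `h` absolutely summable and `e` identically distributed and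
integrable the series converges absolutely almost surely, for every `t`. -/
def input {Ω : Type*} (h : ℕ → ℝ) (e : ℤ → Ω → ℝ) (t : ℤ) (ω : Ω) : ℝ :=
  ∑' k : ℕ, h k * e (t - (k : ℤ)) ω

/-- `Σ`, the covariance matrix of the random vector `(u(0), u(1), …, u(n-1))`. -/
def inputCov {Ω : Type*} [MeasurableSpace Ω] (μ : Measure Ω) (u : ℤ → Ω → ℝ) (n : ℕ) :
    Matrix (Fin n) (Fin n) ℝ :=
  Matrix.of fun i j => covariance (u ((i : ℕ) : ℤ)) (u ((j : ℕ) : ℤ)) μ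

/-- The regression matrix `Φ ∈ ℝ^{N × n}` of an input path `u`: the row of time `t` is
`(u(t-1), …, u(t-n))`, for `t = 1, …, N`. The index `t : Fin N` stands for time `t + 1`, and the
index `i : Fin n` for lag `i + 1`. -/
def regMatrix (u : ℤ → ℝ) (n N : ℕ) : Matrix (Fin N) (Fin n) ℝ :=
  Matrix.of fun t i => u ((((t : ℕ) : ℤ) + 1) - (((i : ℕ) : ℤ) + 1))

/-- The output vector `Y = (y(1), …, y(N))`, where `y(t) = ∑_{i=1}^n g_i u(t-i) + v(t)` and
`θ = (g_1, …, g_n)`. -/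
def output {n : ℕ} (u : ℤ → ℝ) (v : ℕ → ℝ) (θ : EuclideanSpace ℝ (Fin n)) (N : ℕ) :
    Fin N → ℝ :=
  fun t => (∑ i : Fin n, θ i * u ((((t : ℕ) : ℤ) + 1) - (((i : ℕ) : ℤ) + 1))) + v ((t : ℕ) + 1)

/-- The least squares estimator `(ΦᵀΦ)⁻¹ Φᵀ Y`. -/
def lsEstimator {N n : ℕ} (Φ : Matrix (Fin N) (Fin n) ℝ) (Y : Fin N → ℝ) :
    EuclideanSpace ℝ (Fin n) :=
  WithLp.toLp 2 ((Φᵀ * Φ)⁻¹ *ᵥ (Φᵀ *ᵥ Y))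

/-- The noise variance estimator `‖Y - Φ θ_LS‖₂² / (N - n)`. -/
def noiseVarEst {N n : ℕ} (Φ : Matrix (Fin N) (Fin n) ℝ) (Y : Fin N → ℝ) : ℝ :=
  (∑ t : Fin N, (Y t - (Φ *ᵥ (lsEstimator Φ Y).ofLp) t) ^ 2) / ((N : ℝ) - (n : ℝ))

/-- The matrix `Φ P Φᵀ + s I_N`, with the estimated noise variance as `s`. -/
def outputCovEst {N n : ℕ} (Φ : Matrix (Fin N) (Fin n) ℝ) (Y : Fin N → ℝ)
    (P : Matrix (Fin n) (Fin n) ℝ) : Matrix (Fin N) (Fin N) ℝ :=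
  Φ * P * Φᵀ + noiseVarEst Φ Y • (1 : Matrix (Fin N) (Fin N) ℝ)

/-- The empirical Bayes cost `Yᵀ Q⁻¹ Y + log det Q`, where `Q = outputCovEst Φ Y P`. -/
def ebCost {N n : ℕ} (Φ : Matrix (Fin N) (Fin n) ℝ) (Y : Fin N → ℝ)
    (P : Matrix (Fin n) (Fin n) ℝ) : ℝ :=
  Y ⬝ᵥ ((outputCovEst Φ Y P)⁻¹ *ᵥ Y) + Real.log (outputCovEst Φ Y P).det

/-- The regularized least squares estimator `P Φᵀ Q⁻¹ Y`, where `Q = outputCovEst Φ Y P`. -/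
def rlsEstimator {N n : ℕ} (Φ : Matrix (Fin N) (Fin n) ℝ) (Y : Fin N → ℝ)
    (P : Matrix (Fin n) (Fin n) ℝ) : EuclideanSpace ℝ (Fin n) :=
  WithLp.toLp 2 (P *ᵥ (Φᵀ *ᵥ ((outputCovEst Φ Y P)⁻¹ *ᵥ Y)))

/-- The limiting cost `W_b(P, θ) = θᵀ P⁻¹ θ + log det P`. -/
def limitCost {n : ℕ} (P : Matrix (Fin n) (Fin n) ℝ) (θ : EuclideanSpace ℝ (Fin n)) : ℝ :=
  θ.ofLp ⬝ᵥ (P⁻¹ *ᵥ θ.ofLp) + Real.log P.det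

/-- `η_b^* = argmin_{η ∈ Θ} W_b(P(η), θ)`, the set of all minimizers. -/
def limitArgmin {n p : ℕ} (P : EuclideanSpace ℝ (Fin p) → Matrix (Fin n) (Fin n) ℝ)
    (θ : EuclideanSpace ℝ (Fin n)) (Θ : Set (EuclideanSpace ℝ (Fin p))) :
    Set (EuclideanSpace ℝ (Fin p)) :=
  {η | η ∈ Θ ∧ IsMinOn (fun ζ => limitCost (P ζ) θ) Θ η}

end RegFIR

end

noncomputable section

namespace RegFIR

section General

variable {Ω : Type*} [MeasurableSpace Ω] {μ : Measure Ω} [IsProbabilityMeasure μ]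

/-- The first absolute moment is bounded by the root of the second moment. -/
lemma integral_abs_le_sqrt_integral_sq {X : Ω → ℝ} (hX : MemLp X 2 μ) :
    ∫ ω, |X ω| ∂μ ≤ √(∫ ω, X ω ^ 2 ∂μ) := by
  apply Real.le_sqrt_of_sq_le
  have h := variance_eq_sub (μ := μ) (X := fun ω => |X ω|) hX.abs
  have h0 := variance_nonneg (fun ω => |X ω|) μ
  have : ∫ ω, ((fun ω => |X ω|) ^ 2) ω ∂μ = ∫ ω, X ω ^ 2 ∂μ := by simp
  rw [this] at h
  linarith

/-- Averages of orthogonal random variables with bounded second moments tend to `0` in `L¹`. -/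
lemma tendsto_integral_abs_average {X : ℕ → Ω → ℝ} (hX : ∀ t, MemLp (X t) 2 μ) {K : ℝ}
    (hK : ∀ t, ∫ ω, X t ω ^ 2 ∂μ ≤ K)
    (horth : ∀ s t, s < t → ∫ ω, X s ω * X t ω ∂μ = 0) :
    Tendsto (fun N : ℕ => ∫ ω, |(N : ℝ)⁻¹ * ∑ t ∈ Finset.range N, X t ω| ∂μ) atTop (𝓝 0) := by
  have hmem (N : ℕ) : MemLp (fun ω => (N : ℝ)⁻¹ * ∑ t ∈ Finset.range N, X t ω) 2 μ :=
    (memLp_finsetSum _ fun t _ => hX t).const_mul _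
  have hint (s t : ℕ) : Integrable (fun ω => X s ω * X t ω) μ := (hX s).integrable_mul (hX t)
  have horth' (s t : ℕ) (hst : s ≠ t) : ∫ ω, X s ω * X t ω ∂μ = 0 := by
    rcases lt_or_gt_of_ne hst with h | h
    · exact horth s t h
    · simpa only [mul_comm] using horth t s h
  have hsq (N : ℕ) : ∫ ω, ((N : ℝ)⁻¹ * ∑ t ∈ Finset.range N, X t ω) ^ 2 ∂μ ≤ K * (N : ℝ)⁻¹ := by
    have : ∀ ω, ((N : ℝ)⁻¹ * ∑ t ∈ Finset.range N, X t ω) ^ 2 =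
        (N : ℝ)⁻¹ ^ 2 * ∑ s ∈ Finset.range N, ∑ t ∈ Finset.range N, X s ω * X t ω := by
      intro ω
      rw [mul_pow, sq (∑ t ∈ Finset.range N, X t ω), Finset.sum_mul_sum]
    simp_rw [this]
    rw [integral_const_mul,
      integral_finsetSum _ fun s _ => integrable_finsetSum _ fun t _ => hint s t]
    have : ∀ s ∈ Finset.range N, ∫ ω, ∑ t ∈ Finset.range N, X s ω * X t ω ∂μ ≤ K := by
      intro s hs
      rw [integral_finsetSum _ fun t _ => hint s t, Finset.sum_eq_single s]
      · simpa only [sq] using hK s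
      · intro t _ hts
        exact horth' s t hts.symm
      · exact fun h => absurd hs h
    have h2 := Finset.sum_le_sum this
    rw [Finset.sum_const, Finset.card_range, nsmul_eq_mul] at h2
    refine (mul_le_mul_of_nonneg_left h2 (by positivity)).trans ?_
    rcases Nat.eq_zero_or_pos N with rfl | hN
    · simp
    · have : (0 : ℝ) < N := by exact_mod_cast hN
      apply le_of_eq
      field_simp
  have hlim : Tendsto (fun N : ℕ => √(K * (N : ℝ)⁻¹)) atTop (𝓝 0) := by
    have := (tendsto_inv_atTop_nhds_zero_nat (𝕜 := ℝ)).const_mul K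
    rw [mul_zero] at this
    simpa using this.sqrt
  refine squeeze_zero (fun N => integral_nonneg fun _ => abs_nonneg _) (fun N => ?_) hlim
  exact (integral_abs_le_sqrt_integral_sq (hmem N)).trans (Real.sqrt_le_sqrt (hsq N))

/-- If `d N → 0` in `L¹`, and along every subsequence on which `d` tends to `0` at a point the
functions `G` tend to `c` at this point, then `G` tends to `c` in measure. -/
lemma tendstoInMeasure_of_subseq {E : Type*} [PseudoEMetricSpace E]
    {d : ℕ → Ω → ℝ} (hd_int : ∀ N, Integrable (d N) μ)
    (hd : Tendsto (fun N => ∫ ω, |d N ω| ∂μ) atTop (𝓝 0))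
    {G : ℕ → Ω → E} {c : E} (hG : ∀ N, AEStronglyMeasurable (G N) μ)
    (h : ∀ᵐ ω ∂μ, ∀ ns : ℕ → ℕ, StrictMono ns → Tendsto (fun k => d (ns k) ω) atTop (𝓝 0) →
      Tendsto (fun k => G (ns k) ω) atTop (𝓝 c)) :
    TendstoInMeasure μ G atTop (fun _ => c) := by
  have hdm : TendstoInMeasure μ d atTop (0 : Ω → ℝ) := by
    refine tendstoInMeasure_of_tendsto_eLpNorm (p := 1) one_ne_zero
      (fun N => (hd_int N).aestronglyMeasurable) aestronglyMeasurable_zero ?_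
    have : ∀ N, eLpNorm (d N - 0) 1 μ = ENNReal.ofReal (∫ ω, |d N ω| ∂μ) := by
      intro N
      rw [sub_zero, eLpNorm_one_eq_lintegral_enorm,
        ← ofReal_integral_norm_eq_lintegral_enorm (hd_int N)]
      rfl
    simp_rw [this]
    simpa using ENNReal.tendsto_ofReal hd
  rw [exists_seq_tendstoInMeasure_atTop_iff hG]
  intro ns hns
  obtain ⟨ns', hns', hlim⟩ := (hdm.comp hns.tendsto_atTop).exists_seq_tendsto_ae
  refine ⟨ns', hns', ?_⟩
  filter_upwards [hlim, h] with ω h1 h2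
  exact h2 (ns ∘ ns') (hns.comp hns') h1

end General

section CharFun

/-- Cubic bound for the second order expansion of the exponential on the imaginary axis. -/
lemma norm_exp_mul_I_sub_le (y : ℝ) :
    ‖Complex.exp (y * Complex.I) - (1 + y * Complex.I - (y : ℂ) ^ 2 / 2)‖ ≤ 4 * |y| ^ 3 := by
  have hn : ‖(y : ℂ) * Complex.I‖ = |y| := by simp
  rcases le_total |y| 1 with hy | hy
  · have h := Complex.exp_bound (x := y * Complex.I) (by rw [hn]; exact hy) (n := 3) (by norm_num)
    have hs : ∑ m ∈ Finset.range 3, ((y : ℂ) * Complex.I) ^ m / (m.factorial : ℂ) =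
        1 + y * Complex.I - (y : ℂ) ^ 2 / 2 := by
      simp [Finset.sum_range_succ, Nat.factorial, mul_pow]
      ring
    rw [hs, hn] at h
    refine h.trans ?_
    have : (0 : ℝ) ≤ |y| ^ 3 := by positivity
    norm_num [Nat.factorial]
    linarith
  · have h1 : ‖Complex.exp (y * Complex.I)‖ = 1 := Complex.norm_exp_ofReal_mul_I y
    have h2 : ‖1 + y * Complex.I - (y : ℂ) ^ 2 / 2‖ ≤ 1 + |y| + |y| ^ 2 / 2 := by
      refine (norm_sub_le _ _).trans (add_le_add ((norm_add_le _ _).trans (by simp)) (by simp))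
    refine (norm_sub_le _ _).trans ?_
    rw [h1]
    nlinarith [mul_nonneg (abs_nonneg y) (sub_nonneg.2 hy), sq_nonneg (|y|),
      mul_nonneg (sq_nonneg |y|) (sub_nonneg.2 hy)]

variable {Ω : Type*} [MeasurableSpace Ω] {μ : Measure Ω} [IsProbabilityMeasure μ]

/-- The characteristic function of a centred random variable with finite third moment is close to
the one of the normal distribution near the origin. -/
lemma norm_integral_exp_sub_le {V : Ω → ℝ} (hV : MemLp V 3 μ) (hmean : ∫ ω, V ω ∂μ = 0)
    {s : ℝ} (hvar : ∫ ω, V ω ^ 2 ∂μ = s) (a : ℝ) :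
    ‖∫ ω, Complex.exp ((a * V ω : ℝ) * Complex.I) ∂μ - (Real.exp (-(s * a ^ 2 / 2)) : ℂ)‖ ≤
      4 * (∫ ω, |V ω| ^ 3 ∂μ) * |a| ^ 3 + s ^ 2 * a ^ 4 := by
  have hV1 : Integrable V μ := hV.integrable (by norm_num)
  have hV2 : Integrable (fun ω => V ω ^ 2) μ := (hV.mono_exponent (by norm_num)).integrable_sq
  have hV3 : Integrable (fun ω => |V ω| ^ 3) μ := by
    simpa using hV.integrable_norm_pow (by norm_num)
  have hs : 0 ≤ s := hvar ▸ integral_nonneg fun ω => sq_nonneg _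
  have hexp : Integrable (fun ω => Complex.exp ((a * V ω : ℝ) * Complex.I)) μ := by
    refine Integrable.of_bound (C := 1) ?_ (ae_of_all _ fun ω => ?_)
    · have := hV1.aestronglyMeasurable
      fun_prop
    · exact (Complex.norm_exp_ofReal_mul_I _).le
  have hlin : Integrable (fun ω => ((a : ℂ) * Complex.I) * (V ω : ℂ)) μ := hV1.ofReal.const_mul _
  have hquad : Integrable (fun ω => ((a : ℂ) ^ 2 / 2) * ((V ω ^ 2 : ℝ) : ℂ)) μ :=
    hV2.ofReal.const_mul _
  have hpoly : ∀ ω, 1 + ((a * V ω : ℝ) : ℂ) * Complex.I - ((a * V ω : ℝ) : ℂ) ^ 2 / 2 =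
      1 + ((a : ℂ) * Complex.I) * (V ω : ℂ) - ((a : ℂ) ^ 2 / 2) * ((V ω ^ 2 : ℝ) : ℂ) := by
    intro ω
    push_cast
    ring
  have hpoly_int : Integrable (fun ω => 1 + ((a * V ω : ℝ) : ℂ) * Complex.I -
      ((a * V ω : ℝ) : ℂ) ^ 2 / 2) μ := by
    simp_rw [hpoly]
    exact ((integrable_const _).add hlin).sub hquad
  have hpoly_val : ∫ ω, (1 + ((a * V ω : ℝ) : ℂ) * Complex.I - ((a * V ω : ℝ) : ℂ) ^ 2 / 2) ∂μ =
      ((1 - s * a ^ 2 / 2 : ℝ) : ℂ) := by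
    simp_rw [hpoly]
    have hadd : Integrable (fun ω => 1 + ((a : ℂ) * Complex.I) * (V ω : ℂ)) μ :=
      (integrable_const _).add hlin
    rw [integral_sub hadd hquad, integral_add (integrable_const _) hlin, integral_const_mul,
      integral_const_mul,
      integral_complex_ofReal, integral_complex_ofReal, hmean, hvar]
    simp
    ring
  have h1 : ‖∫ ω, Complex.exp ((a * V ω : ℝ) * Complex.I) ∂μ - ((1 - s * a ^ 2 / 2 : ℝ) : ℂ)‖ ≤
      4 * (∫ ω, |V ω| ^ 3 ∂μ) * |a| ^ 3 := by
    rw [← hpoly_val, ← integral_sub hexp hpoly_int]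
    refine (norm_integral_le_of_norm_le (hV3.const_mul (4 * |a| ^ 3))
      (ae_of_all _ fun ω => ?_)).trans ?_
    · refine (norm_exp_mul_I_sub_le (a * V ω)).trans (le_of_eq ?_)
      rw [abs_mul]
      ring
    · rw [integral_const_mul]
      apply le_of_eq
      ring
  have h2 : ‖((1 - s * a ^ 2 / 2 : ℝ) : ℂ) - (Real.exp (-(s * a ^ 2 / 2)) : ℂ)‖ ≤
      s ^ 2 * a ^ 4 := by
    rw [← Complex.ofReal_sub, Complex.norm_real, Real.norm_eq_abs]
    set y := s * a ^ 2 / 2 with hy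
    have hy0 : 0 ≤ y := by positivity
    have hyle : y ^ 2 ≤ s ^ 2 * a ^ 4 := by
      rw [hy]
      nlinarith [sq_nonneg (s * a ^ 2)]
    refine le_trans ?_ hyle
    rcases le_total y 1 with h | h
    · have := Real.abs_exp_sub_one_sub_id_le (x := -y) (by rwa [abs_neg, abs_of_nonneg hy0])
      rw [show 1 - y - Real.exp (-y) = -(Real.exp (-y) - 1 - -y) by ring, abs_neg]
      exact this.trans (by rw [neg_sq])
    · have h3 := Real.add_one_le_exp (-y)
      have h4 : Real.exp (-y) ≤ 1 := Real.exp_le_one_iff.2 (by linarith)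
      rw [abs_le]
      constructor <;> nlinarith
  calc _ ≤ _ := norm_sub_le_norm_sub_add_norm_sub _ ((1 - s * a ^ 2 / 2 : ℝ) : ℂ) _
    _ ≤ _ := add_le_add h1 h2

/-- Products of complex numbers of norm at most one depend on the factors in a Lipschitz way. -/
lemma norm_prod_sub_prod_le {ι : Type*} (S : Finset ι) {f g : ι → ℂ} (hf : ∀ i, ‖f i‖ ≤ 1)
    (hg : ∀ i, ‖g i‖ ≤ 1) : ‖∏ i ∈ S, f i - ∏ i ∈ S, g i‖ ≤ ∑ i ∈ S, ‖f i - g i‖ := by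
  classical
  induction S using Finset.induction_on with
  | empty => simp
  | insert i S hi ih =>
    rw [Finset.prod_insert hi, Finset.prod_insert hi, Finset.sum_insert hi]
    have : f i * ∏ j ∈ S, f j - g i * ∏ j ∈ S, g j =
        (f i - g i) * ∏ j ∈ S, f j + g i * (∏ j ∈ S, f j - ∏ j ∈ S, g j) := by ring
    rw [this]
    refine (norm_add_le _ _).trans (add_le_add ?_ ?_)
    · rw [norm_mul, norm_prod]
      exact mul_le_of_le_one_right (norm_nonneg _)
        (Finset.prod_le_one (fun _ _ => norm_nonneg _) fun j _ => hf j)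
    · rw [norm_mul]
      exact (mul_le_of_le_one_left (norm_nonneg _) (hg i)).trans ih

/-- Fubini for a product of phases whose amplitudes are independent of the noise. -/
lemma integral_prod_exp_eq {x W : ℕ → Ω → ℝ} (hx : ∀ t, Measurable (x t))
    (hW : ∀ t, Measurable (W t)) (hind : IndepFun (fun ω t => x t ω) (fun ω t => W t ω) μ)
    (hW_ind : iIndepFun W μ) (hW_ident : ∀ s t, IdentDistrib (W s) (W t) μ μ) (c : ℝ) (N : ℕ) :
    ∫ ω, ∏ t ∈ Finset.range N, Complex.exp ((c * x t ω * W t ω : ℝ) * Complex.I) ∂μ =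
      ∫ ω, ∏ t ∈ Finset.range N,
        ∫ ω', Complex.exp ((c * x t ω * W 0 ω' : ℝ) * Complex.I) ∂μ ∂μ := by
  have hX : Measurable (fun ω t => x t ω) := measurable_pi_lambda _ hx
  have hWW : Measurable (fun ω t => W t ω) := measurable_pi_lambda _ hW
  set F : (ℕ → ℝ) × (ℕ → ℝ) → ℂ := fun p =>
    ∏ t ∈ Finset.range N, Complex.exp ((c * p.1 t * p.2 t : ℝ) * Complex.I) with hF
  have hFm : Measurable F := by
    refine Finset.measurable_prod _ fun t _ => ?_
    fun_prop
  have hFb : ∀ p, ‖F p‖ ≤ 1 := fun p => by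
    rw [hF, norm_prod]
    exact Finset.prod_le_one (fun _ _ => norm_nonneg _)
      fun t _ => (Complex.norm_exp_ofReal_mul_I _).le
  have := Measure.isProbabilityMeasure_map (μ := μ) hX.aemeasurable
  have := Measure.isProbabilityMeasure_map (μ := μ) hWW.aemeasurable
  have hFi : Integrable F ((μ.map fun ω t => x t ω).prod (μ.map fun ω t => W t ω)) :=
    Integrable.of_bound hFm.aestronglyMeasurable 1 (ae_of_all _ hFb)
  have hFs := hFm.stronglyMeasurable
  calc _ = ∫ ω, F ((fun t => x t ω), (fun t => W t ω)) ∂μ := rfl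
    _ = ∫ p, F p ∂(μ.map fun ω => ((fun t => x t ω), (fun t => W t ω))) := by
      rw [integral_map (hX.prodMk hWW).aemeasurable hFm.aestronglyMeasurable]
    _ = ∫ y, ∫ w, F (y, w) ∂(μ.map fun ω t => W t ω) ∂(μ.map fun ω t => x t ω) := by
      rw [(indepFun_iff_map_prod_eq_prod_map_map hX.aemeasurable hWW.aemeasurable).1 hind,
        integral_prod _ hFi]
    _ = ∫ ω, ∫ w, F ((fun t => x t ω), w) ∂(μ.map fun ω t => W t ω) ∂μ := by
      rw [integral_map hX.aemeasurable]
      exact hFs.integral_prod_right.aestronglyMeasurable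
    _ = _ := by
      congr 1
      ext ω
      have hFx : Measurable fun w => F ((fun t => x t ω), w) := hFm.comp measurable_prodMk_left
      rw [integral_map hWW.aemeasurable hFx.aestronglyMeasurable]
      simp only [hF]
      simp_rw [Finset.prod_range]
      have hW_fin : iIndepFun (fun (i : Fin N) => W i) μ := hW_ind.precomp Fin.val_injective
      have h := iIndepFun.integral_fun_prod_comp (ι := Fin N) (X := fun i => W i) (𝕜 := ℂ)
          (f := fun i y => Complex.exp ((c * x i ω * y : ℝ) * Complex.I))
          hW_fin (fun i => (hW i).aemeasurable) (fun i => by fun_prop)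
      refine h.trans (Finset.prod_congr rfl fun i _ => ?_)
      exact ((hW_ident i 0).comp (u := fun y => Complex.exp ((c * x i ω * y : ℝ) * Complex.I))
        (by fun_prop)).integral_eq

/-- Central limit theorem for weighted sums of i.i.d. noise, with random weights `x` that are
independent of the noise `W` and whose averaged squares converge in `L¹` to a constant `q`. -/
lemma tendsto_integral_exp_weighted_sum {x W : ℕ → Ω → ℝ} (hx : ∀ t, Measurable (x t))
    (hW : ∀ t, Measurable (W t)) (hind : IndepFun (fun ω t => x t ω) (fun ω t => W t ω) μ)
    (hW_ind : iIndepFun W μ) (hW_ident : ∀ s t, IdentDistrib (W s) (W t) μ μ)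
    (hW3 : MemLp (W 0) 3 μ) (hW_mean : ∫ ω, W 0 ω ∂μ = 0) {s : ℝ}
    (hW_var : ∫ ω, W 0 ω ^ 2 ∂μ = s) (hx4 : ∀ t, Integrable (fun ω => x t ω ^ 4) μ) {K : ℝ}
    (hK : ∀ t, ∫ ω, x t ω ^ 4 ∂μ ≤ K) {q : ℝ} (hq : 0 ≤ q)
    (hlim : Tendsto (fun N : ℕ =>
      ∫ ω, |(N : ℝ)⁻¹ * ∑ t ∈ Finset.range N, x t ω ^ 2 - q| ∂μ) atTop (𝓝 0)) :
    Tendsto (fun N : ℕ => ∫ ω, Complex.exp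
      (((√(N : ℝ))⁻¹ * ∑ t ∈ Finset.range N, x t ω * W t ω : ℝ) * Complex.I) ∂μ) atTop
      (𝓝 (Real.exp (-(s * q / 2)) : ℂ)) := by
  have hs : 0 ≤ s := hW_var ▸ integral_nonneg fun ω => sq_nonneg _
  set M := ∫ ω, |W 0 ω| ^ 3 ∂μ with hM
  have hM0 : 0 ≤ M := integral_nonneg fun ω => by positivity
  set ψ : ℝ → ℂ := fun a => ∫ ω', Complex.exp ((a * W 0 ω' : ℝ) * Complex.I) ∂μ with hψ
  have hψ1 : ∀ a, ‖ψ a‖ ≤ 1 := fun a => by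
    refine (norm_integral_le_of_norm_le (integrable_const (1 : ℝ)) (ae_of_all _ fun ω => ?_)).trans
      (by simp)
    exact (Complex.norm_exp_ofReal_mul_I _).le
  have hψm : Measurable ψ := by
    have : StronglyMeasurable fun p : ℝ × Ω => Complex.exp ((p.1 * W 0 p.2 : ℝ) * Complex.I) := by
      have := hW 0
      exact Measurable.stronglyMeasurable (by fun_prop)
    exact this.integral_prod_right.measurable
  have hx2 : ∀ t, Integrable (fun ω => x t ω ^ 2) μ := fun t => by
    refine ((integrable_const (1 : ℝ)).add (hx4 t)).mono' ((hx t).pow_const 2).aestronglyMeasurable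
      (ae_of_all _ fun ω => ?_)
    simp only [Pi.add_apply, Real.norm_eq_abs, abs_pow, sq_abs]
    nlinarith [sq_nonneg (x t ω ^ 2 - 1), sq_nonneg (x t ω ^ 2)]
  have havg : ∀ N : ℕ, Integrable
      (fun ω => |(N : ℝ)⁻¹ * ∑ t ∈ Finset.range N, x t ω ^ 2 - q|) μ := fun N =>
    (((integrable_finsetSum _ fun t _ => hx2 t).const_mul _).sub (integrable_const q)).abs
  have key : ∀ N : ℕ, ‖(∫ ω, Complex.exp
      (((√(N : ℝ))⁻¹ * ∑ t ∈ Finset.range N, x t ω * W t ω : ℝ) * Complex.I) ∂μ) -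
        (Real.exp (-(s * q / 2)) : ℂ)‖ ≤
      (4 * M + s ^ 2) * (1 + K) * (√(N : ℝ))⁻¹ +
        s / 2 * ∫ ω, |(N : ℝ)⁻¹ * ∑ t ∈ Finset.range N, x t ω ^ 2 - q| ∂μ := by
    intro N
    set c := (√(N : ℝ))⁻¹ with hc
    have hc0 : 0 ≤ c := by positivity
    have hc2 : c ^ 2 = (N : ℝ)⁻¹ := by rw [hc, inv_pow, Real.sq_sqrt (Nat.cast_nonneg N)]
    have hcN : c ^ 2 * N ≤ 1 := by rw [hc2]; exact inv_mul_le_one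
    have hc1 : c ≤ 1 := by
      rcases Nat.eq_zero_or_pos N with h | h
      · simp [hc, h]
      · exact inv_le_one_of_one_le₀ (Real.one_le_sqrt.2 (by exact_mod_cast h))
    have hexp : ∀ ω, Complex.exp
        ((c * ∑ t ∈ Finset.range N, x t ω * W t ω : ℝ) * Complex.I) =
        ∏ t ∈ Finset.range N, Complex.exp ((c * x t ω * W t ω : ℝ) * Complex.I) := by
      intro ω
      rw [← Complex.exp_sum, ← Finset.sum_mul, ← Complex.ofReal_sum, Finset.mul_sum]
      simp_rw [mul_assoc]
    simp_rw [hexp]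
    rw [integral_prod_exp_eq hx hW hind hW_ind hW_ident]
    have hint : Integrable (fun ω => ∏ t ∈ Finset.range N, ψ (c * x t ω)) μ := by
      refine Integrable.of_bound (C := 1) ?_ (ae_of_all _ fun ω => ?_)
      · exact (Finset.measurable_prod _ fun t _ =>
          hψm.comp ((hx t).const_mul c)).aestronglyMeasurable
      · rw [norm_prod]
        exact Finset.prod_le_one (fun _ _ => norm_nonneg _) fun t _ => hψ1 _
    have hsub : (∫ ω, ∏ t ∈ Finset.range N, ψ (c * x t ω) ∂μ) - (Real.exp (-(s * q / 2)) : ℂ) =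
        ∫ ω, (∏ t ∈ Finset.range N, ψ (c * x t ω) - (Real.exp (-(s * q / 2)) : ℂ)) ∂μ := by
      rw [integral_sub hint (integrable_const _)]
      simp
    refine (congrArg norm hsub).le.trans ?_
    have hx4' : ∀ t, Integrable (fun ω => 1 + x t ω ^ 4) μ := fun t =>
      (integrable_const _).add (hx4 t)
    have hgi : Integrable (fun ω => (4 * M + s ^ 2) * c ^ 3 *
        ∑ t ∈ Finset.range N, (1 + x t ω ^ 4)) μ :=
      (integrable_finsetSum _ fun t _ => hx4' t).const_mul _
    refine (norm_integral_le_of_norm_le (hgi.add ((havg N).const_mul (s / 2)))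
      (ae_of_all _ fun ω => ?_)).trans ?_
    · set r := (N : ℝ)⁻¹ * ∑ t ∈ Finset.range N, x t ω ^ 2 with hr
      have hr0 : 0 ≤ r := mul_nonneg (by positivity) (Finset.sum_nonneg fun _ _ => sq_nonneg _)
      have hg : ∏ t ∈ Finset.range N, (Real.exp (-(s * (c * x t ω) ^ 2 / 2)) : ℂ) =
          (Real.exp (-(s * r / 2)) : ℂ) := by
        rw [← Complex.ofReal_prod, ← Real.exp_sum, hr, ← hc2]
        congr 2
        rw [Finset.sum_neg_distrib, Finset.mul_sum, Finset.mul_sum, Finset.sum_div]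
        congr 1
        exact Finset.sum_congr rfl fun _ _ => by ring
      have h1 : ‖∏ t ∈ Finset.range N, ψ (c * x t ω) - (Real.exp (-(s * r / 2)) : ℂ)‖ ≤
          (4 * M + s ^ 2) * c ^ 3 * ∑ t ∈ Finset.range N, (1 + x t ω ^ 4) := by
        rw [← hg]
        refine (norm_prod_sub_prod_le _ (fun t => hψ1 (c * x t ω)) fun t => ?_).trans ?_
        · rw [Complex.norm_real, Real.norm_eq_abs, abs_of_pos (Real.exp_pos _)]
          exact Real.exp_le_one_iff.2 (neg_nonpos.2 (by positivity))
        · rw [Finset.mul_sum]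
          refine Finset.sum_le_sum fun t _ => ?_
          refine (norm_integral_exp_sub_le hW3 hW_mean hW_var (c * x t ω)).trans ?_
          rw [← hM, abs_mul, abs_of_nonneg hc0, mul_pow, mul_pow]
          set y := |x t ω|
          have hy : x t ω ^ 4 = y ^ 4 := by
            rw [← abs_pow, abs_of_nonneg (by positivity : (0 : ℝ) ≤ x t ω ^ 4)]
          have hy0 : 0 ≤ y := abs_nonneg _
          rw [hy]
          have hy3 : y ^ 3 ≤ 1 + y ^ 4 := by
            rcases le_total y 1 with h | h
            · have := pow_le_one₀ (n := 3) hy0 h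
              nlinarith [pow_nonneg hy0 4]
            · nlinarith [pow_nonneg hy0 3]
          have hc3 : 0 ≤ c ^ 3 := by positivity
          have h4 : c ^ 4 * y ^ 4 ≤ c ^ 3 * (1 + y ^ 4) := by
            have : c ^ 4 ≤ c ^ 3 := pow_le_pow_of_le_one hc0 hc1 (by norm_num)
            nlinarith [pow_nonneg hy0 4]
          have h3 : c ^ 3 * y ^ 3 ≤ c ^ 3 * (1 + y ^ 4) := mul_le_mul_of_nonneg_left hy3 hc3
          have h5 := mul_le_mul_of_nonneg_left h3 (by positivity : 0 ≤ 4 * M)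
          have h6 := mul_le_mul_of_nonneg_left h4 (sq_nonneg s)
          linarith
      have h2 : ‖(Real.exp (-(s * r / 2)) : ℂ) - (Real.exp (-(s * q / 2)) : ℂ)‖ ≤
          s / 2 * |r - q| := by
        rw [← Complex.ofReal_sub, Complex.norm_real, Real.norm_eq_abs]
        have hexp_le : ∀ a b : ℝ, 0 ≤ a → a ≤ b → |Real.exp (-a) - Real.exp (-b)| ≤ b - a := by
          intro a b ha hab
          have e1 : Real.exp (-b) ≤ Real.exp (-a) := Real.exp_le_exp.2 (by linarith)
          have e2 : Real.exp (-b) = Real.exp (-a) * Real.exp (-(b - a)) := by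
            rw [← Real.exp_add]
            congr 1
            ring
          have e3 := Real.add_one_le_exp (-(b - a))
          have e4 : Real.exp (-a) ≤ 1 := Real.exp_le_one_iff.2 (by linarith)
          rw [abs_of_nonneg (by linarith), e2]
          nlinarith [Real.exp_pos (-a)]
        rcases le_total r q with h | h
        · rw [abs_of_nonpos (by linarith : r - q ≤ 0)]
          refine (hexp_le _ _ (by positivity) ?_).trans (le_of_eq (by ring))
          gcongr
        · rw [abs_of_nonneg (by linarith : 0 ≤ r - q), abs_sub_comm]
          refine (hexp_le _ _ (by positivity) ?_).trans (le_of_eq (by ring))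
          gcongr
      exact (norm_sub_le_norm_sub_add_norm_sub _ (Real.exp (-(s * r / 2)) : ℂ) _).trans
        (add_le_add h1 h2)
    · simp only [Pi.add_apply]
      rw [integral_add hgi ((havg N).const_mul (s / 2)), integral_const_mul, integral_const_mul,
        integral_finsetSum _ fun t _ => hx4' t]
      refine add_le_add ?_ le_rfl
      have h1 : ∑ t ∈ Finset.range N, ∫ ω, (1 + x t ω ^ 4) ∂μ ≤ N * (1 + K) := by
        refine (Finset.sum_le_sum fun t _ => ?_).trans_eq
          (by rw [Finset.sum_const, Finset.card_range, nsmul_eq_mul])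
        rw [integral_add (integrable_const _) (hx4 t)]
        simpa using hK t
      have hK0 : 0 ≤ K := le_trans (integral_nonneg fun ω => by positivity) (hK 0)
      calc (4 * M + s ^ 2) * c ^ 3 * ∑ t ∈ Finset.range N, ∫ ω, (1 + x t ω ^ 4) ∂μ
          ≤ (4 * M + s ^ 2) * c ^ 3 * (N * (1 + K)) := by gcongr
        _ = (4 * M + s ^ 2) * (1 + K) * c * (c ^ 2 * N) := by ring
        _ ≤ (4 * M + s ^ 2) * (1 + K) * c * 1 := by gcongr
        _ = _ := mul_one _
  rw [tendsto_iff_norm_sub_tendsto_zero]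
  refine squeeze_zero (fun _ => norm_nonneg _) key ?_
  have hsqrt : Tendsto (fun N : ℕ => (√(N : ℝ))⁻¹) atTop (𝓝 0) :=
    tendsto_inv_atTop_zero.comp (Real.tendsto_sqrt_atTop.comp tendsto_natCast_atTop_atTop)
  simpa using (hsqrt.const_mul ((4 * M + s ^ 2) * (1 + K))).add (hlim.const_mul (s / 2))

end CharFun

section

variable {Ω : Type*} [MeasurableSpace Ω] {μ : Measure Ω}

/-- Independent centred random variables with common second moment `s` and fourth moment `m`. -/
structure IsWhiteNoise {ι : Type*} (e : ι → Ω → ℝ) (μ : Measure Ω) (s m : ℝ) : Prop where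
  measurable : ∀ t, Measurable (e t)
  indep : iIndepFun e μ
  memLp : ∀ t, MemLp (e t) 4 μ
  mean : ∀ t, ∫ ω, e t ω ∂μ = 0
  second : ∀ t, ∫ ω, e t ω ^ 2 ∂μ = s
  fourth : ∀ t, ∫ ω, e t ω ^ 4 ∂μ = m

/-- Identically distributed, independent, centred random variables with finite moments of an order
above four form a white noise. -/
lemma isWhiteNoise_of_identDistrib [IsProbabilityMeasure μ] {ι : Type*} {e : ι → Ω → ℝ} {s : ℝ}
    (hmeas : ∀ t, Measurable (e t)) (hindep : iIndepFun e μ)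
    (hident : ∀ s t, IdentDistrib (e s) (e t) μ μ) (hmean : ∀ t, ∫ ω, e t ω ∂μ = 0)
    (hvar : ∀ t, variance (e t) μ = s)
    (hmom : ∃ δ : ℝ, 0 < δ ∧ ∀ t, MemLp (e t) (ENNReal.ofReal (4 + δ)) μ) (t₀ : ι) :
    IsWhiteNoise e μ s (∫ ω, e t₀ ω ^ 4 ∂μ) where
  measurable := hmeas
  indep := hindep
  memLp t := by
    obtain ⟨δ, hδ, h⟩ := hmom
    refine (h t).mono_exponent ?_
    rw [show (4 : ENNReal) = ENNReal.ofReal 4 by simp]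
    exact ENNReal.ofReal_le_ofReal (by linarith)
  mean := hmean
  second t := by
    rw [← hvar t, variance_of_integral_eq_zero (hmeas t).aemeasurable (hmean t)]
  fourth t := ((hident t t₀).comp (u := fun y : ℝ => y ^ 4) (by fun_prop)).integral_eq

lemma memLp_two_mul {f g : Ω → ℝ} (hf : MemLp f 4 μ) (hg : MemLp g 4 μ) :
    MemLp (fun ω => f ω * g ω) 2 μ := by
  have : ENNReal.HolderTriple 4 4 2 := ⟨by
    rw [← two_mul, show (4 : ENNReal) = 2 * 2 by norm_num,
      ENNReal.mul_inv (by simp) (by simp), ← mul_assoc, ENNReal.mul_inv_cancel (by simp) (by simp),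
      one_mul]⟩
  exact hg.mul' hf

namespace IsWhiteNoise

variable {ι : Type*} {e : ι → Ω → ℝ} {s m : ℝ}

lemma integrable_pow_four (he : IsWhiteNoise e μ s m) (t : ι) :
    Integrable (fun ω => e t ω ^ 4) μ := by
  have := (he.memLp t).integrable_norm_pow (by norm_num)
  refine this.congr (ae_of_all _ fun ω => ?_)
  simp only [Real.norm_eq_abs]
  exact Even.pow_abs (by decide) _

lemma nonneg [Nonempty ι] (he : IsWhiteNoise e μ s m) : 0 ≤ s :=
  he.second (Classical.arbitrary ι) ▸ integral_nonneg fun _ => sq_nonneg _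

lemma integral_mul [DecidableEq ι] (he : IsWhiteNoise e μ s m) (a b : ι) :
    ∫ ω, e a ω * e b ω ∂μ = if a = b then s else 0 := by
  split_ifs with h
  · subst h
    rw [← he.second a]
    exact integral_congr_ae (ae_of_all _ fun ω => (pow_two _).symm)
  · rw [(he.indep.indepFun h).integral_fun_mul_eq_mul_integral
      (he.measurable a).aestronglyMeasurable (he.measurable b).aestronglyMeasurable, he.mean a,
      zero_mul]

/-- A product of four noise variables has mean zero if one index differs from the others. -/
lemma integral_mul_four_eq_zero (he : IsWhiteNoise e μ s m) {a b c d : ι} (ha : a ≠ d)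
    (hb : b ≠ d) (hc : c ≠ d) : ∫ ω, (e a ω * e b ω) * (e c ω * e d ω) ∂μ = 0 := by
  classical
  have hdisj : Disjoint ({a, b, c} : Finset ι) {d} := by
    simp [ha.symm, hb.symm, hc.symm]
  have h := he.indep.indepFun_finset _ _ hdisj he.measurable
  have hd : Measurable fun y : (({d} : Finset ι) → ℝ) => y ⟨d, by simp⟩ := measurable_pi_apply _
  have h' := h.comp
    (φ := fun y : (({a, b, c} : Finset ι) → ℝ) =>
      y ⟨a, by simp⟩ * y ⟨b, by simp⟩ * y ⟨c, by simp⟩)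
    (by fun_prop) hd
  have hm := he.measurable
  have h'' := IndepFun.integral_fun_mul_eq_mul_integral (𝕜 := ℝ) h'
    (by simp only [Function.comp_def]; exact Measurable.aestronglyMeasurable (by fun_prop))
    (by simp only [Function.comp_def]; exact Measurable.aestronglyMeasurable (by fun_prop))
  simp only [Function.comp_def, he.mean d, mul_zero] at h''
  rw [← h'']
  exact integral_congr_ae (ae_of_all _ fun ω => by ring)

variable [IsProbabilityMeasure μ]

lemma memLp_two (he : IsWhiteNoise e μ s m) (t : ι) : MemLp (e t) 2 μ :=
  (he.memLp t).mono_exponent (by norm_num)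

lemma integrable (he : IsWhiteNoise e μ s m) (t : ι) : Integrable (e t) μ :=
  (he.memLp t).integrable (by norm_num)

lemma integrable_mul (he : IsWhiteNoise e μ s m) (a b : ι) :
    Integrable (fun ω => e a ω * e b ω) μ :=
  (he.memLp_two a).integrable_mul (he.memLp_two b)

lemma integral_abs_mul_le (he : IsWhiteNoise e μ s m) (a b : ι) :
    ∫ ω, |e a ω * e b ω| ∂μ ≤ s := by
  have ha := (he.memLp_two a).integrable_sq
  have hb := (he.memLp_two b).integrable_sq
  calc ∫ ω, |e a ω * e b ω| ∂μ ≤ ∫ ω, (2⁻¹ * e a ω ^ 2 + 2⁻¹ * e b ω ^ 2) ∂μ := by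
        refine integral_mono (he.integrable_mul a b).abs
          ((ha.const_mul _).add (hb.const_mul _)) fun ω => ?_
        change |e a ω * e b ω| ≤ 2⁻¹ * e a ω ^ 2 + 2⁻¹ * e b ω ^ 2
        rw [abs_le]
        constructor
        · nlinarith [sq_nonneg (e a ω + e b ω)]
        · nlinarith [sq_nonneg (e a ω - e b ω)]
    _ = s := by
        rw [integral_add (ha.const_mul _) (hb.const_mul _), integral_const_mul, integral_const_mul,
          he.second, he.second]
        ring

/-- Weak law for squares: the averages of `e(f t)²`, for distinct indices `f t`, tend to `s`. -/
lemma tendsto_average_sq (he : IsWhiteNoise e μ s m) {f : ℕ → ι} (hf : Function.Injective f) :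
    Tendsto (fun N : ℕ => ∫ ω, |(N : ℝ)⁻¹ * ∑ t ∈ Finset.range N, (e (f t) ω ^ 2 - s)| ∂μ) atTop
      (𝓝 0) := by
  have hsq : ∀ t, MemLp (fun ω => e t ω ^ 2) 2 μ := fun t => by
    simpa only [pow_two] using memLp_two_mul (he.memLp t) (he.memLp t)
  have hmem : ∀ t, MemLp (fun ω => e t ω ^ 2 - s) 2 μ := fun t => (hsq t).sub (memLp_const s)
  have hmean : ∀ t, ∫ ω, (e t ω ^ 2 - s) ∂μ = 0 := fun t => by
    rw [integral_sub (he.memLp_two t).integrable_sq (integrable_const _), he.second]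
    simp
  refine tendsto_integral_abs_average (fun t => hmem (f t)) (K := 2 * m + 2 * s ^ 2)
    (fun t => ?_) fun t t' htt' => ?_
  · have hi := he.integrable_pow_four (f t)
    calc ∫ ω, (e (f t) ω ^ 2 - s) ^ 2 ∂μ ≤ ∫ ω, (2 * e (f t) ω ^ 4 + 2 * s ^ 2) ∂μ := by
          refine integral_mono (hmem (f t)).integrable_sq
            ((hi.const_mul 2).add (integrable_const _)) fun ω => ?_
          change (e (f t) ω ^ 2 - s) ^ 2 ≤ 2 * e (f t) ω ^ 4 + 2 * s ^ 2
          nlinarith [sq_nonneg (e (f t) ω ^ 2 + s)]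
      _ = 2 * m + 2 * s ^ 2 := by
          rw [integral_add (hi.const_mul 2) (integrable_const _), integral_const_mul, he.fourth]
          simp
  · have h := (he.indep.indepFun (hf.ne htt'.ne)).comp
      (φ := fun y : ℝ => y ^ 2 - s) (ψ := fun y : ℝ => y ^ 2 - s) (by fun_prop) (by fun_prop)
    have h' := IndepFun.integral_fun_mul_eq_mul_integral (𝕜 := ℝ) h (hmem _).aestronglyMeasurable
      (hmem _).aestronglyMeasurable
    simpa only [Function.comp_def, hmean, mul_zero] using h'

end IsWhiteNoise

section Integers

variable [IsProbabilityMeasure μ] {e : ℤ → Ω → ℝ} {s m : ℝ}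

lemma IsWhiteNoise.tendsto_average_mul_of_lt (he : IsWhiteNoise e μ s m) {a b : ℤ} (hab : a < b) :
    Tendsto (fun N : ℕ =>
      ∫ ω, |(N : ℝ)⁻¹ * ∑ t ∈ Finset.range N, e (t + a) ω * e (t + b) ω| ∂μ) atTop (𝓝 0) := by
  refine tendsto_integral_abs_average
    (fun t => memLp_two_mul (he.memLp (t + a)) (he.memLp (t + b))) (K := m) (fun t => ?_)
    fun t t' htt' => he.integral_mul_four_eq_zero (by omega) (by omega) (by omega)
  have ha := he.integrable_pow_four (t + a)
  have hb := he.integrable_pow_four (t + b)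
  calc ∫ ω, (e (t + a) ω * e (t + b) ω) ^ 2 ∂μ
      ≤ ∫ ω, (2⁻¹ * e (t + a) ω ^ 4 + 2⁻¹ * e (t + b) ω ^ 4) ∂μ := by
        refine integral_mono (memLp_two_mul (he.memLp _) (he.memLp _)).integrable_sq
          ((ha.const_mul _).add (hb.const_mul _)) fun ω => ?_
        change (e (t + a) ω * e (t + b) ω) ^ 2 ≤ 2⁻¹ * e (t + a) ω ^ 4 + 2⁻¹ * e (t + b) ω ^ 4
        nlinarith [sq_nonneg (e (t + a) ω ^ 2 - e (t + b) ω ^ 2)]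
    _ = m := by
        rw [integral_add (ha.const_mul _) (hb.const_mul _), integral_const_mul, integral_const_mul,
          he.fourth, he.fourth]
        ring

/-- Weak law for the sample autocovariances of a white noise. -/
lemma IsWhiteNoise.tendsto_average_mul (he : IsWhiteNoise e μ s m) (a b : ℤ) :
    Tendsto (fun N : ℕ => ∫ ω, |(N : ℝ)⁻¹ * ∑ t ∈ Finset.range N,
      (e (t + a) ω * e (t + b) ω - if a = b then s else 0)| ∂μ) atTop (𝓝 0) := by
  rcases lt_trichotomy a b with h | h | h
  · simpa [h.ne] using he.tendsto_average_mul_of_lt h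
  · subst h
    have := he.tendsto_average_sq (f := fun t : ℕ => (t : ℤ) + a)
      (fun x y hxy => by simpa using hxy)
    simpa only [pow_two, if_true] using this
  · simpa [h.ne', mul_comm] using he.tendsto_average_mul_of_lt h

lemma IsWhiteNoise.integral_abs_average_mul_le (he : IsWhiteNoise e μ s m) (a b : ℤ) (N : ℕ) :
    ∫ ω, |(N : ℝ)⁻¹ * ∑ t ∈ Finset.range N,
      (e (t + a) ω * e (t + b) ω - if a = b then s else 0)| ∂μ ≤ 2 * s := by
  have hs := he.nonneg
  set κ : ℝ := if a = b then s else 0 with hκ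
  have hκs : |κ| ≤ s := by
    rw [hκ]
    split_ifs <;> simp [hs, abs_of_nonneg]
  have hi : ∀ t : ℕ, Integrable (fun ω => e (t + a) ω * e (t + b) ω - κ) μ := fun t =>
    (he.integrable_mul _ _).sub (integrable_const _)
  have hone : ∀ t : ℕ, ∫ ω, |e (t + a) ω * e (t + b) ω - κ| ∂μ ≤ 2 * s := fun t => by
    have hadd : Integrable (fun ω => |e (t + a) ω * e (t + b) ω| + |κ|) μ :=
      (he.integrable_mul _ _).abs.add (integrable_const _)
    refine (integral_mono (hi t).abs hadd fun ω => abs_sub _ _).trans ?_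
    rw [integral_add (he.integrable_mul _ _).abs (integrable_const _)]
    have := he.integral_abs_mul_le (t + a) (t + b)
    rw [integral_const, probReal_univ, one_smul]
    linarith
  have hsum : Integrable (fun ω => (N : ℝ)⁻¹ * ∑ t ∈ Finset.range N,
      |e (t + a) ω * e (t + b) ω - κ|) μ :=
    (integrable_finsetSum _ fun t _ => (hi t).abs).const_mul _
  refine (integral_mono ((integrable_finsetSum _ fun t _ => hi t).const_mul _).abs hsum
    fun ω => ?_).trans ?_
  · change |(N : ℝ)⁻¹ * ∑ t ∈ Finset.range N, (e (t + a) ω * e (t + b) ω - κ)| ≤ _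
    rw [abs_mul, abs_of_nonneg (by positivity : (0 : ℝ) ≤ (N : ℝ)⁻¹)]
    exact mul_le_mul_of_nonneg_left (Finset.abs_sum_le_sum_abs _ _) (by positivity)
  · rw [integral_const_mul, integral_finsetSum _ fun t _ => (hi t).abs]
    have h1 := Finset.sum_le_sum fun t (_ : t ∈ Finset.range N) => hone t
    rw [Finset.sum_const, Finset.card_range, nsmul_eq_mul] at h1
    calc _ ≤ (N : ℝ)⁻¹ * (N * (2 * s)) := mul_le_mul_of_nonneg_left h1 (by positivity)
      _ = ((N : ℝ)⁻¹ * N) * (2 * s) := by ring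
      _ ≤ 1 * (2 * s) := mul_le_mul_of_nonneg_right inv_mul_le_one (by positivity)
      _ = _ := one_mul _

end Integers

section Input

variable {e : ℤ → Ω → ℝ} {s m : ℝ} {h : ℕ → ℝ}

lemma eLpNorm_four_eq {f : Ω → ℝ} (hf : MemLp f 4 μ) :
    eLpNorm f 4 μ = ENNReal.ofReal ((∫ ω, f ω ^ 4 ∂μ) ^ (4⁻¹ : ℝ)) := by
  rw [hf.eLpNorm_eq_integral_rpow_norm (by norm_num) (by norm_num)]
  congr 2
  · refine integral_congr_ae (ae_of_all _ fun ω => ?_)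
    change ‖f ω‖ ^ (ENNReal.toReal 4) = f ω ^ 4
    rw [show ENNReal.toReal 4 = ((4 : ℕ) : ℝ) by norm_num, Real.rpow_natCast, Real.norm_eq_abs]
    exact Even.pow_abs (by decide) _

lemma integral_pow_four_le {f : Ω → ℝ} (hf : MemLp f 4 μ) {C : ENNReal} (hC : C ≠ ⊤)
    (hle : eLpNorm f 4 μ ≤ C) : ∫ ω, f ω ^ 4 ∂μ ≤ C.toReal ^ 4 := by
  have h0 : 0 ≤ ∫ ω, f ω ^ 4 ∂μ := integral_nonneg fun _ => by positivity
  rw [eLpNorm_four_eq hf] at hle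
  have h1 := (ENNReal.ofReal_le_iff_le_toReal hC).1 hle
  have h2 := pow_le_pow_left₀ (by positivity) h1 4
  refine le_trans (le_of_eq ?_) h2
  rw [← Real.rpow_natCast, ← Real.rpow_mul h0]
  norm_num

/-- The `L¹` norm of a series is at most the sum of the `L¹` norms of its terms. -/
lemma integral_abs_tsum_le {ι : Type*} [Countable ι] {F : ι → Ω → ℝ}
    (hF : ∀ i, Integrable (F i) μ) (hsum : Summable fun i => ∫ ω, |F i ω| ∂μ) :
    ∫ ω, |∑' i, F i ω| ∂μ ≤ ∑' i, ∫ ω, |F i ω| ∂μ := by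
  have hm : AEStronglyMeasurable (fun ω => ∑' i, F i ω) μ :=
    (AEMeasurable.tsum fun i => (hF i).aemeasurable).aestronglyMeasurable
  have h0 : ∀ i, 0 ≤ ∫ ω, |F i ω| ∂μ := fun i => integral_nonneg fun _ => abs_nonneg _
  have h := integral_norm_eq_lintegral_enorm hm
  simp only [Real.norm_eq_abs] at h
  rw [h]
  refine ENNReal.toReal_le_of_le_ofReal (tsum_nonneg h0) ?_
  rw [ENNReal.ofReal_tsum_of_nonneg h0 hsum]
  calc ∫⁻ ω, ‖∑' i, F i ω‖ₑ ∂μ ≤ ∫⁻ ω, ∑' i, ‖F i ω‖ₑ ∂μ :=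
        lintegral_mono fun ω => enorm_tsum_le_tsum_enorm
    _ = ∑' i, ∫⁻ ω, ‖F i ω‖ₑ ∂μ := lintegral_tsum fun i => (hF i).aemeasurable.enorm
    _ = _ := tsum_congr fun i => by
        rw [← ofReal_integral_norm_eq_lintegral_enorm (hF i)]
        rfl

lemma IsWhiteNoise.measurable_input (he : IsWhiteNoise e μ s m) (h : ℕ → ℝ) (t : ℤ) :
    Measurable (input h e t) :=
  Measurable.tsum fun k => (he.measurable _).const_mul _

lemma IsWhiteNoise.eLpNorm_const_mul (he : IsWhiteNoise e μ s m) (c : ℝ) (t : ℤ) :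
    eLpNorm (fun ω => c * e t ω) 4 μ = ‖c‖ₑ * ENNReal.ofReal (m ^ (4⁻¹ : ℝ)) := by
  have := eLpNorm_const_smul c (e t) 4 μ
  rw [eLpNorm_four_eq (he.memLp t), he.fourth] at this
  exact this

lemma tsum_enorm_mul_ne_top (hh : Summable fun k => |h k|) (c : ℝ) :
    ∑' k, ‖h k‖ₑ * ENNReal.ofReal c ≠ ⊤ := by
  rw [ENNReal.tsum_mul_right]
  exact ENNReal.mul_ne_top (tsum_enorm_ne_top_iff_summable_norm.2 hh) ENNReal.ofReal_ne_top

/-- The series defining the input converges absolutely, almost surely. -/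
lemma IsWhiteNoise.ae_summable_input (he : IsWhiteNoise e μ s m) (hh : Summable fun k => |h k|) :
    ∀ᵐ ω ∂μ, ∀ t : ℤ, Summable fun k : ℕ => ‖h k * e (t - k) ω‖ := by
  refine ae_all_iff.2 fun t => ?_
  refine summable_norm_of_tsum_eLpNorm_ne_top (p := 4) (by norm_num)
    (fun k => ((he.measurable _).const_mul _).aestronglyMeasurable) ?_
  simp_rw [he.eLpNorm_const_mul]
  exact tsum_enorm_mul_ne_top hh _

lemma IsWhiteNoise.exists_eLpNorm_input_le (he : IsWhiteNoise e μ s m)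
    (hh : Summable fun k => |h k|) :
    ∃ C : ENNReal, C ≠ ⊤ ∧ ∀ t, eLpNorm (input h e t) 4 μ ≤ C := by
  refine ⟨_, tsum_enorm_mul_ne_top hh (m ^ (4⁻¹ : ℝ)), fun t => ?_⟩
  have hm : ∀ k : ℕ, AEStronglyMeasurable (fun ω => h k * e (t - k) ω) μ := fun k =>
    ((he.measurable _).const_mul _).aestronglyMeasurable
  refine Lp.eLpNorm_le_of_ae_tendsto (u := atTop)
    (f := fun n : ℕ => ∑ k ∈ Finset.range n, fun ω => h k * e (t - k) ω)
    (Eventually.of_forall fun n => ?_)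
    (fun n => Finset.aestronglyMeasurable_sum _ fun k _ => hm k) ?_
  · refine (eLpNorm_sum_le (fun k _ => hm k) (by norm_num)).trans ?_
    simp_rw [he.eLpNorm_const_mul]
    exact ENNReal.sum_le_tsum _
  · filter_upwards [he.ae_summable_input hh] with ω hω
    simp only [Finset.sum_apply]
    exact (hω t).of_norm.hasSum.tendsto_sum_nat

lemma IsWhiteNoise.memLp_input (he : IsWhiteNoise e μ s m) (hh : Summable fun k => |h k|) (t : ℤ) :
    MemLp (input h e t) 4 μ := by
  obtain ⟨C, hC, hle⟩ := he.exists_eLpNorm_input_le hh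
  exact ⟨(he.measurable_input h t).aestronglyMeasurable, (hle t).trans_lt hC.lt_top⟩

variable [IsProbabilityMeasure μ]

lemma IsWhiteNoise.integral_input (he : IsWhiteNoise e μ s m) (hh : Summable fun k => |h k|)
    (t : ℤ) : ∫ ω, input h e t ω ∂μ = 0 := by
  have hsum : Summable fun k : ℕ => ∫ ω, ‖h k * e (t - k) ω‖ ∂μ := by
    refine Summable.of_nonneg_of_le (fun _ => integral_nonneg fun _ => norm_nonneg _)
      (fun k => ?_) (hh.mul_right √s)
    simp_rw [Real.norm_eq_abs, abs_mul]
    rw [integral_const_mul]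
    refine mul_le_mul_of_nonneg_left ?_ (abs_nonneg _)
    rw [← he.second (t - k)]
    exact integral_abs_le_sqrt_integral_sq (he.memLp_two _)
  have h1 := integral_tsum_of_summable_integral_norm
    (fun k : ℕ => (he.integrable (t - k)).const_mul (h k)) hsum
  simp only [integral_const_mul, he.mean, mul_zero, tsum_zero] at h1
  exact h1.symm

lemma summable_abs_mul_abs (hh : Summable fun k => |h k|) (c : ℝ) :
    Summable fun z : ℕ × ℕ => |h z.1| * |h z.2| * c :=
  (hh.mul_of_nonneg hh (fun _ => abs_nonneg _) fun _ => abs_nonneg _).mul_right c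

/-- The autocovariances of the input. -/
lemma IsWhiteNoise.integral_input_mul (he : IsWhiteNoise e μ s m) (hh : Summable fun k => |h k|)
    (a b : ℤ) : ∫ ω, input h e a ω * input h e b ω ∂μ =
      ∑' z : ℕ × ℕ, h z.1 * h z.2 * (if a - (z.1 : ℤ) = b - z.2 then s else 0) := by
  have hsum : Summable fun z : ℕ × ℕ =>
      ∫ ω, ‖h z.1 * h z.2 * (e (a - z.1) ω * e (b - z.2) ω)‖ ∂μ := by
    refine Summable.of_nonneg_of_le (fun _ => integral_nonneg fun _ => norm_nonneg _)
      (fun z => ?_) (summable_abs_mul_abs hh s)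
    simp_rw [Real.norm_eq_abs, abs_mul (h z.1 * h z.2)]
    rw [integral_const_mul, abs_mul]
    exact mul_le_mul_of_nonneg_left (he.integral_abs_mul_le _ _) (by positivity)
  have h1 := integral_tsum_of_summable_integral_norm
    (fun z : ℕ × ℕ => (he.integrable_mul (a - z.1) (b - z.2)).const_mul (h z.1 * h z.2)) hsum
  simp only [integral_const_mul, he.integral_mul] at h1
  rw [h1]
  refine integral_congr_ae ?_
  filter_upwards [he.ae_summable_input hh] with ω hω
  simp only [input]
  rw [tsum_mul_tsum_of_summable_norm (hω a) (hω b)]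
  exact tsum_congr fun z => by ring

/-- The autocovariance only depends on the absolute value of the lag. -/
lemma IsWhiteNoise.integral_input_mul_neg (he : IsWhiteNoise e μ s m)
    (hh : Summable fun k => |h k|) (a b : ℤ) :
    ∫ ω, input h e (-a) ω * input h e (-b) ω ∂μ = ∫ ω, input h e a ω * input h e b ω ∂μ := by
  rw [he.integral_input_mul hh, he.integral_input_mul hh,
    ← (Equiv.prodComm ℕ ℕ).tsum_eq]
  refine tsum_congr fun z => ?_
  simp only [Equiv.prodComm_apply, Prod.fst_swap, Prod.snd_swap]
  rw [mul_comm (h z.2)]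
  congr 2
  exact propext ⟨fun _ => by omega, fun _ => by omega⟩

/-- Weak law for the sample autocovariances of the input. -/
lemma IsWhiteNoise.tendsto_average_input_mul (he : IsWhiteNoise e μ s m)
    (hh : Summable fun k => |h k|) (a b : ℤ) :
    Tendsto (fun N : ℕ => ∫ ω, |(N : ℝ)⁻¹ * ∑ t ∈ Finset.range N,
      (input h e (t + a) ω * input h e (t + b) ω - ∫ ω', input h e a ω' * input h e b ω' ∂μ)| ∂μ)
      atTop (𝓝 0) := by
  set κ : ℕ × ℕ → ℝ := fun z => if a - (z.1 : ℤ) = b - z.2 then s else 0 with hκ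
  set S : ℕ → ℕ × ℕ → Ω → ℝ := fun N z ω => (N : ℝ)⁻¹ * ∑ t ∈ Finset.range N,
    (e (t + (a - z.1)) ω * e (t + (b - z.2)) ω - κ z) with hS
  have hs := he.nonneg
  have hS_int : ∀ N z, Integrable (S N z) μ := fun N z =>
    (integrable_finsetSum _ fun t _ =>
      (he.integrable_mul _ _).sub (integrable_const _)).const_mul _
  have hS_le : ∀ N z, ∫ ω, |S N z ω| ∂μ ≤ 2 * s := fun N z =>
    he.integral_abs_average_mul_le (a - z.1) (b - z.2) N
  have hS_lim : ∀ z, Tendsto (fun N => ∫ ω, |S N z ω| ∂μ) atTop (𝓝 0) := fun z =>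
    he.tendsto_average_mul (a - z.1) (b - z.2)
  have hF : ∀ N (z : ℕ × ℕ), ∫ ω, |h z.1 * h z.2 * S N z ω| ∂μ =
      |h z.1| * |h z.2| * ∫ ω, |S N z ω| ∂μ := fun N z => by
    simp_rw [abs_mul]
    rw [integral_const_mul]
  have hbound : ∀ N (z : ℕ × ℕ), ‖|h z.1| * |h z.2| * ∫ ω, |S N z ω| ∂μ‖ ≤
      |h z.1| * |h z.2| * (2 * s) := fun N z => by
    have h0 : 0 ≤ ∫ ω, |S N z ω| ∂μ := integral_nonneg fun _ => abs_nonneg _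
    rw [Real.norm_of_nonneg (by positivity)]
    exact mul_le_mul_of_nonneg_left (hS_le N z) (by positivity)
  have hκ_sum : Summable fun z : ℕ × ℕ => h z.1 * h z.2 * κ z := by
    refine Summable.of_norm_bounded (summable_abs_mul_abs hh s) fun z => ?_
    rw [norm_mul, norm_mul, Real.norm_eq_abs, Real.norm_eq_abs]
    refine mul_le_mul_of_nonneg_left ?_ (by positivity)
    rw [hκ]
    dsimp only
    split_ifs <;> simp [hs, abs_of_nonneg]
  have hrep : ∀ N : ℕ, (fun ω => (N : ℝ)⁻¹ * ∑ t ∈ Finset.range N,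
      (input h e (t + a) ω * input h e (t + b) ω - ∫ ω', input h e a ω' * input h e b ω' ∂μ))
      =ᵐ[μ] fun ω => ∑' z : ℕ × ℕ, h z.1 * h z.2 * S N z ω := by
    intro N
    filter_upwards [he.ae_summable_input hh] with ω hω
    have hterm : ∀ t : ℕ, Summable (fun z : ℕ × ℕ =>
        h z.1 * e (t + a - z.1) ω * (h z.2 * e (t + b - z.2) ω) - h z.1 * h z.2 * κ z) := fun t =>
      (summable_mul_of_summable_norm (hω (t + a)) (hω (t + b))).sub hκ_sum
    rw [he.integral_input_mul hh]
    have : ∀ t : ℕ, input h e (t + a) ω * input h e (t + b) ω -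
        ∑' z : ℕ × ℕ, h z.1 * h z.2 * κ z = ∑' z : ℕ × ℕ,
          (h z.1 * e (t + a - z.1) ω * (h z.2 * e (t + b - z.2) ω) - h z.1 * h z.2 * κ z) := by
      intro t
      rw [(summable_mul_of_summable_norm (hω (t + a)) (hω (t + b))).tsum_sub hκ_sum,
        ← tsum_mul_tsum_of_summable_norm (hω (t + a)) (hω (t + b))]
      rfl
    rw [Finset.sum_congr rfl fun t _ => this t, ← Summable.tsum_finsetSum fun t _ => hterm t,
      ← tsum_mul_left]
    refine tsum_congr fun z => ?_
    rw [hS]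
    dsimp only
    rw [mul_left_comm, Finset.mul_sum _ _ (h z.1 * h z.2)]
    congr 1
    refine Finset.sum_congr rfl fun t _ => ?_
    rw [add_sub_assoc, add_sub_assoc]
    ring
  have hdom : Tendsto (fun N => ∑' z : ℕ × ℕ, |h z.1| * |h z.2| * ∫ ω, |S N z ω| ∂μ) atTop
      (𝓝 0) := by
    have := tendsto_tsum_of_dominated_convergence (summable_abs_mul_abs hh (2 * s))
      (fun z : ℕ × ℕ => (hS_lim z).const_mul (|h z.1| * |h z.2|))
      (Eventually.of_forall fun N z => hbound N z)
    simpa using this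
  refine squeeze_zero (fun N => integral_nonneg fun _ => abs_nonneg _) (fun N => ?_) hdom
  have hcongr := integral_congr_ae ((hrep N).fun_comp fun y => |y|)
  simp only [Function.comp_def] at hcongr
  rw [hcongr]
  refine (integral_abs_tsum_le (fun z => (hS_int N z).const_mul _) ?_).trans_eq
    (tsum_congr fun z => hF N z)
  simp_rw [hF]
  exact Summable.of_norm_bounded (summable_abs_mul_abs hh (2 * s)) fun z => hbound N z

end Input

end

section

section LinearAlgebra

variable {N n : ℕ}

/-- The normalized Gram matrix `ΦᵀΦ / N`. -/
def gram (Φ : Matrix (Fin N) (Fin n) ℝ) : Matrix (Fin n) (Fin n) ℝ := (N : ℝ)⁻¹ • (Φᵀ * Φ)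

/-- The normalized score `ΦᵀV / N`. -/
def score (Φ : Matrix (Fin N) (Fin n) ℝ) (V : Fin N → ℝ) : Fin n → ℝ := (N : ℝ)⁻¹ • (Φᵀ *ᵥ V)

lemma eq_inv_mulVec {A : Matrix (Fin n) (Fin n) ℝ} (hA : IsUnit A.det) {x y : Fin n → ℝ}
    (h : A *ᵥ x = y) : x = A⁻¹ *ᵥ y := by
  rw [← h, mulVec_mulVec, nonsing_inv_mul _ hA, one_mulVec]

/-- Estimation error of least squares. -/
lemma lsEstimator_eq {Φ : Matrix (Fin N) (Fin n) ℝ} (hdet : IsUnit (gram Φ).det)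
    (θ : Fin n → ℝ) (V : Fin N → ℝ) :
    (lsEstimator Φ (Φ *ᵥ θ + V)).ofLp = θ + (gram Φ)⁻¹ *ᵥ score Φ V := by
  have hdet' : IsUnit (Φᵀ * Φ).det := by
    rw [gram, det_smul, isUnit_iff_ne_zero] at hdet
    exact isUnit_iff_ne_zero.2 (right_ne_zero_of_mul hdet)
  have h : (lsEstimator Φ (Φ *ᵥ θ + V)).ofLp = θ + (Φᵀ * Φ)⁻¹ *ᵥ (Φᵀ *ᵥ V) := by
    simp only [lsEstimator]
    rw [mulVec_add, mulVec_add, mulVec_mulVec θ, mulVec_mulVec θ, nonsing_inv_mul _ hdet',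
      one_mulVec]
  rw [h]
  congr 1
  refine eq_inv_mulVec hdet ?_
  rw [gram, score, smul_mulVec, mulVec_mulVec, mul_nonsing_inv _ hdet', one_mulVec]

/-- Estimation error of regularized least squares. -/
lemma rlsEstimator_eq {Φ : Matrix (Fin N) (Fin n) ℝ} {θ : Fin n → ℝ} {V : Fin N → ℝ}
    {P : Matrix (Fin n) (Fin n) ℝ} (hP : P.PosDef) {s : ℝ}
    (hs : noiseVarEst Φ (Φ *ᵥ θ + V) = s) (hs0 : 0 < s)
    (hdet : IsUnit (gram Φ + (s / N) • P⁻¹).det) :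
    (rlsEstimator Φ (Φ *ᵥ θ + V) P).ofLp =
      θ + (gram Φ + (s / N) • P⁻¹)⁻¹ *ᵥ (score Φ V - (s / N) • (P⁻¹ *ᵥ θ)) := by
  set Y := Φ *ᵥ θ + V with hY
  set Q := outputCovEst Φ Y P with hQ
  have hQ_eq : Q = Φ * P * Φᵀ + s • (1 : Matrix (Fin N) (Fin N) ℝ) := by
    rw [hQ, outputCovEst, hs]
  have hQ_pos : Q.PosDef := by
    rw [hQ_eq]
    refine PosDef.posSemidef_add ?_ (PosDef.one.smul hs0)
    simpa using hP.posSemidef.mul_mul_conjTranspose_same Φ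
  have hQ_det : IsUnit Q.det := isUnit_iff_ne_zero.2 hQ_pos.det_pos.ne'
  have hP_det : IsUnit P.det := isUnit_iff_ne_zero.2 hP.det_pos.ne'
  have hpush : (Φᵀ * Φ + s • P⁻¹) * P * Φᵀ = Φᵀ * Q := by
    rw [hQ_eq, Matrix.add_mul, smul_mul, nonsing_inv_mul _ hP_det, Matrix.add_mul, Matrix.mul_add,
      smul_mul, Matrix.one_mul, Matrix.mul_smul, Matrix.mul_one]
    simp only [Matrix.mul_assoc]
  have hnormal : (Φᵀ * Φ + s • P⁻¹) *ᵥ (rlsEstimator Φ Y P).ofLp = Φᵀ *ᵥ Y := by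
    simp only [rlsEstimator]
    rw [← hQ, mulVec_mulVec, mulVec_mulVec, mulVec_mulVec, hpush, Matrix.mul_assoc,
      mul_nonsing_inv _ hQ_det, Matrix.mul_one]
  have hM : gram Φ + (s / N) • P⁻¹ = (N : ℝ)⁻¹ • (Φᵀ * Φ + s • P⁻¹) := by
    rw [gram, smul_add, smul_smul]
    congr 2
    ring
  rw [← sub_eq_iff_eq_add']
  refine eq_inv_mulVec hdet ?_
  rw [mulVec_sub]
  nth_rewrite 1 [hM]
  rw [smul_mulVec, hnormal, hY, mulVec_add, smul_add, score, Matrix.add_mulVec, gram, smul_mulVec,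
    smul_mulVec, mulVec_mulVec]
  abel

/-- The noise variance estimator in terms of normalized quantities. -/
lemma noiseVarEst_eq {Φ : Matrix (Fin N) (Fin n) ℝ} (hN : 0 < N) (hdet : IsUnit (gram Φ).det)
    (θ : Fin n → ℝ) (V : Fin N → ℝ) :
    noiseVarEst Φ (Φ *ᵥ θ + V) = ((N : ℝ)⁻¹ * ∑ t, V t ^ 2 -
      score Φ V ⬝ᵥ ((gram Φ)⁻¹ *ᵥ score Φ V)) * (1 - n / (N : ℝ))⁻¹ := by
  have hN' : (N : ℝ) ≠ 0 := by exact_mod_cast hN.ne'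
  set x := (gram Φ)⁻¹ *ᵥ score Φ V with hx
  have hgx : gram Φ *ᵥ x = score Φ V := by
    rw [hx, mulVec_mulVec, mul_nonsing_inv _ hdet, one_mulVec]
  have hscore : Φᵀ *ᵥ V = (N : ℝ) • score Φ V := by
    rw [score, smul_smul, mul_inv_cancel₀ hN', one_smul]
  have hgram : (Φᵀ * Φ) *ᵥ x = (N : ℝ) • score Φ V := by
    rw [← hgx, gram, smul_mulVec, smul_smul, mul_inv_cancel₀ hN', one_smul]
  have hcross : V ⬝ᵥ (Φ *ᵥ x) = N * (score Φ V ⬝ᵥ x) := by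
    rw [dotProduct_mulVec, ← mulVec_transpose, hscore, smul_dotProduct, smul_eq_mul]
  have hquad : (Φ *ᵥ x) ⬝ᵥ (Φ *ᵥ x) = N * (score Φ V ⬝ᵥ x) := by
    rw [dotProduct_mulVec, ← mulVec_transpose, mulVec_mulVec, hgram, smul_dotProduct, smul_eq_mul]
  have hres : ∑ t, ((Φ *ᵥ θ + V) t - (Φ *ᵥ (lsEstimator Φ (Φ *ᵥ θ + V)).ofLp) t) ^ 2 =
      ∑ t, V t ^ 2 - N * (score Φ V ⬝ᵥ x) := by
    rw [lsEstimator_eq hdet, ← hx, mulVec_add]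
    have : ∀ t, ((Φ *ᵥ θ + V) t - (Φ *ᵥ θ + Φ *ᵥ x) t) ^ 2 =
        V t ^ 2 - 2 * (V t * (Φ *ᵥ x) t) + (Φ *ᵥ x) t * (Φ *ᵥ x) t := fun t => by
      simp only [Pi.add_apply]
      ring
    simp_rw [this]
    rw [Finset.sum_add_distrib, Finset.sum_sub_distrib, ← Finset.mul_sum]
    change ∑ t, V t ^ 2 - 2 * (V ⬝ᵥ (Φ *ᵥ x)) + (Φ *ᵥ x) ⬝ᵥ (Φ *ᵥ x) = _
    rw [hcross, hquad]
    ring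
  rw [noiseVarEst, hres]
  have hfac : (N : ℝ) - n = N * (1 - n / N) := by field_simp
  rw [hfac, div_eq_mul_inv, mul_inv, ← mul_assoc]
  congr 1
  field_simp

end LinearAlgebra

section Limits

variable {n : ℕ} {l : Filter ℕ} {S : Matrix (Fin n) (Fin n) ℝ}

lemma tendsto_matrix_inv {ι : Type*} {l : Filter ι} {A : ι → Matrix (Fin n) (Fin n) ℝ}
    (hS : S.det ≠ 0) (hA : Tendsto A l (𝓝 S)) : Tendsto (fun k => (A k)⁻¹) l (𝓝 S⁻¹) := by
  have : ContinuousAt Ring.inverse S.det := by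
    rw [Ring.inverse_eq_inv']
    exact continuousAt_inv₀ hS
  exact (continuousAt_matrix_inv S this).tendsto.comp hA

lemma eventually_isUnit_det {ι : Type*} {l : Filter ι} {A : ι → Matrix (Fin n) (Fin n) ℝ}
    (hS : S.det ≠ 0) (hA : Tendsto A l (𝓝 S)) : ∀ᶠ k in l, IsUnit (A k).det := by
  have : Tendsto (fun k => (A k).det) l (𝓝 S.det) :=
    ((continuous_id.matrix_det).tendsto S).comp hA
  exact (this.eventually_ne hS).mono fun k hk => isUnit_iff_ne_zero.2 hk

lemma tendsto_smul_of_bounded {ι : Type*} {l : Filter ι} {c : ι → ℝ} (hc : Tendsto c l (𝓝 0))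
    {B : ι → Matrix (Fin n) (Fin n) ℝ} {C : ℝ} (hB : ∀ k i j, |B k i j| ≤ C) :
    Tendsto (fun k => c k • B k) l (𝓝 0) := by
  refine tendsto_pi_nhds.2 fun i => tendsto_pi_nhds.2 fun j => ?_
  refine squeeze_zero_norm (a := fun k => |c k| * C) (fun k => ?_) ?_
  · rw [Matrix.smul_apply, norm_smul]
    exact mul_le_mul_of_nonneg_left (hB k i j) (norm_nonneg _)
  · simpa using hc.abs.mul_const C

lemma tendsto_mulVec {ι : Type*} {l : Filter ι} {A : ι → Matrix (Fin n) (Fin n) ℝ}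
    {x : ι → Fin n → ℝ} {y : Fin n → ℝ} (hA : Tendsto A l (𝓝 S)) (hx : Tendsto x l (𝓝 y)) :
    Tendsto (fun k => A k *ᵥ x k) l (𝓝 (S *ᵥ y)) := by
  have hc : Continuous fun p : Matrix (Fin n) (Fin n) ℝ × (Fin n → ℝ) => p.1 *ᵥ p.2 :=
    Continuous.matrix_mulVec continuous_fst continuous_snd
  exact (hc.tendsto (S, y)).comp (hA.prodMk_nhds hx)

/-- Consistency of the noise variance estimator. -/
lemma tendsto_noiseVarEst (hl : l ≤ atTop) (hS : S.det ≠ 0) (θ : Fin n → ℝ)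
    {Φ : (N : ℕ) → Matrix (Fin N) (Fin n) ℝ} {V : (N : ℕ) → Fin N → ℝ} {s : ℝ}
    (hgram : Tendsto (fun N => gram (Φ N)) l (𝓝 S))
    (hscore : Tendsto (fun N => score (Φ N) (V N)) l (𝓝 0))
    (hsq : Tendsto (fun N : ℕ => (N : ℝ)⁻¹ * ∑ t, V N t ^ 2) l (𝓝 s)) :
    Tendsto (fun N => noiseVarEst (Φ N) (Φ N *ᵥ θ + V N)) l (𝓝 s) := by
  have hinv := tendsto_matrix_inv hS hgram
  have hmv := tendsto_mulVec hinv hscore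
  have hdot : Continuous fun p : (Fin n → ℝ) × (Fin n → ℝ) => p.1 ⬝ᵥ p.2 :=
    Continuous.dotProduct continuous_fst continuous_snd
  have hquad := (hdot.tendsto (0, S⁻¹ *ᵥ 0)).comp (hscore.prodMk_nhds hmv)
  have hratio : Tendsto (fun N : ℕ => (1 - n / (N : ℝ))⁻¹) l (𝓝 1) := by
    have h1 : Tendsto (fun N : ℕ => 1 - n / (N : ℝ)) atTop (𝓝 (1 - 0)) :=
      tendsto_const_nhds.sub (tendsto_const_div_atTop_nhds_zero_nat _)
    simpa using (h1.inv₀ (by norm_num)).mono_left hl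
  have hmain := (hsq.sub hquad).mul hratio
  simp only [zero_dotProduct, sub_zero, mul_one] at hmain
  refine hmain.congr' ?_
  filter_upwards [eventually_isUnit_det hS hgram, hl (eventually_gt_atTop 0)] with N hN hN0
  exact (noiseVarEst_eq hN0 hN θ (V N)).symm

end Limits

section Measurability

instance instMeasurableSpaceMatrix {m n : Type*} : MeasurableSpace (Matrix m n ℝ) :=
  inferInstanceAs (MeasurableSpace (m → n → ℝ))

instance instBorelSpaceMatrix {m n : Type*} [Countable m] [Countable n] :
    BorelSpace (Matrix m n ℝ) :=
  inferInstanceAs (BorelSpace (m → n → ℝ))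

instance instSecondCountableMatrix {m n : Type*} [Countable m] [Countable n] :
    SecondCountableTopology (Matrix m n ℝ) :=
  inferInstanceAs (SecondCountableTopology (m → n → ℝ))

variable {Ω : Type*} [MeasurableSpace Ω] {μ : Measure Ω}

lemma aemeasurable_matrix {m n : Type*} [Countable m] [Countable n] {A : Ω → Matrix m n ℝ}
    (hA : ∀ i j, AEMeasurable (fun ω => A ω i j) μ) : AEMeasurable A μ :=
  aemeasurable_pi_lambda (fun ω => (A ω : m → n → ℝ)) fun i => aemeasurable_pi_lambda _ (hA i)

variable {l m n : Type*} [Fintype l] [Fintype m] [Fintype n]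

lemma aemeasurable_matrix_transpose {A : Ω → Matrix m n ℝ} (hA : AEMeasurable A μ) :
    AEMeasurable (fun ω => (A ω)ᵀ) μ :=
  (continuous_id.matrix_transpose).measurable.comp_aemeasurable hA

lemma aemeasurable_matrix_mul {A : Ω → Matrix l m ℝ} {B : Ω → Matrix m n ℝ}
    (hA : AEMeasurable A μ) (hB : AEMeasurable B μ) : AEMeasurable (fun ω => A ω * B ω) μ :=
  (Continuous.matrix_mul continuous_fst continuous_snd).aemeasurable2 hA hB

lemma aemeasurable_matrix_add {A B : Ω → Matrix m n ℝ}
    (hA : AEMeasurable A μ) (hB : AEMeasurable B μ) : AEMeasurable (fun ω => A ω + B ω) μ :=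
  (continuous_fst.add continuous_snd).aemeasurable2 hA hB

lemma aemeasurable_matrix_smul {c : Ω → ℝ} {A : Ω → Matrix m n ℝ}
    (hc : AEMeasurable c μ) (hA : AEMeasurable A μ) : AEMeasurable (fun ω => c ω • A ω) μ :=
  (continuous_fst.smul continuous_snd).aemeasurable2 hc hA

lemma aemeasurable_mulVec {A : Ω → Matrix m n ℝ} {v : Ω → n → ℝ}
    (hA : AEMeasurable A μ) (hv : AEMeasurable v μ) : AEMeasurable (fun ω => A ω *ᵥ v ω) μ :=
  (Continuous.matrix_mulVec continuous_fst continuous_snd).aemeasurable2 hA hv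

lemma aemeasurable_matrix_inv [DecidableEq n] {A : Ω → Matrix n n ℝ} (hA : AEMeasurable A μ) :
    AEMeasurable (fun ω => (A ω)⁻¹) μ := by
  simp_rw [inv_def, Ring.inverse_eq_inv']
  exact aemeasurable_matrix_smul
    ((continuous_id.matrix_det).measurable.comp_aemeasurable hA).inv
    ((continuous_id.matrix_adjugate).measurable.comp_aemeasurable hA)

variable {N n : ℕ} {Φ : Ω → Matrix (Fin N) (Fin n) ℝ} {Y : Ω → Fin N → ℝ}

lemma aemeasurable_lsEstimator (hΦ : AEMeasurable Φ μ) (hY : AEMeasurable Y μ) :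
    AEMeasurable (fun ω => lsEstimator (Φ ω) (Y ω)) μ := by
  have hT := aemeasurable_matrix_transpose hΦ
  exact (WithLp.measurable_toLp 2 _).comp_aemeasurable (aemeasurable_mulVec
    (aemeasurable_matrix_inv (aemeasurable_matrix_mul hT hΦ)) (aemeasurable_mulVec hT hY))

lemma aemeasurable_noiseVarEst (hΦ : AEMeasurable Φ μ) (hY : AEMeasurable Y μ) :
    AEMeasurable (fun ω => noiseVarEst (Φ ω) (Y ω)) μ := by
  have h1 : AEMeasurable (fun ω => Φ ω *ᵥ (lsEstimator (Φ ω) (Y ω)).ofLp) μ :=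
    aemeasurable_mulVec hΦ
      ((WithLp.measurable_ofLp 2 _).comp_aemeasurable (aemeasurable_lsEstimator hΦ hY))
  refine AEMeasurable.div_const (Finset.aemeasurable_fun_sum _ fun t _ => ?_) _
  exact (((measurable_pi_apply t).comp_aemeasurable hY).sub
    ((measurable_pi_apply t).comp_aemeasurable h1)).pow_const 2

lemma aemeasurable_rlsEstimator (hΦ : AEMeasurable Φ μ) (hY : AEMeasurable Y μ)
    {P : Ω → Matrix (Fin n) (Fin n) ℝ} (hP : AEMeasurable P μ) :
    AEMeasurable (fun ω => rlsEstimator (Φ ω) (Y ω) (P ω)) μ := by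
  have hT := aemeasurable_matrix_transpose hΦ
  have hQ : AEMeasurable (fun ω => outputCovEst (Φ ω) (Y ω) (P ω)) μ :=
    aemeasurable_matrix_add (aemeasurable_matrix_mul (aemeasurable_matrix_mul hΦ hP) hT)
      (aemeasurable_matrix_smul (aemeasurable_noiseVarEst hΦ hY) aemeasurable_const)
  exact (WithLp.measurable_toLp 2 _).comp_aemeasurable (aemeasurable_mulVec hP
    (aemeasurable_mulVec hT (aemeasurable_mulVec (aemeasurable_matrix_inv hQ) hY)))

end Measurability

end

section

variable {Ω : Type*} [MeasurableSpace Ω] {μ : Measure Ω}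

section Slutsky

variable [IsProbabilityMeasure μ] {n : ℕ}

/-- Slutsky's theorem for random linear perturbations: `A N y N + b N` has the same limit law as
`y N` if `A N → 1` and `b N → 0` along each path on which `d N → 0`, where `d N → 0` in `L¹`. -/
lemma tendstoInDistribution_of_perturbation {ν : Measure (EuclideanSpace ℝ (Fin n))}
    [IsProbabilityMeasure ν] {y X : ℕ → Ω → EuclideanSpace ℝ (Fin n)}
    (hy : TendstoInDistribution y atTop id (fun _ => μ) ν)
    {d : ℕ → Ω → ℝ} (hd_int : ∀ N, Integrable (d N) μ)
    (hd : Tendsto (fun N => ∫ ω, |d N ω| ∂μ) atTop (𝓝 0))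
    {A : ℕ → Ω → Matrix (Fin n) (Fin n) ℝ} {b : ℕ → Ω → Fin n → ℝ}
    (hA : ∀ N, AEMeasurable (A N) μ) (hb : ∀ N, AEMeasurable (b N) μ)
    (hX : ∀ N, AEMeasurable (X N) μ)
    (hlim : ∀ᵐ ω ∂μ, ∀ l : Filter ℕ, l ≤ atTop → Tendsto (fun N => d N ω) l (𝓝 0) →
      Tendsto (fun N => A N ω) l (𝓝 1) ∧ Tendsto (fun N => b N ω) l (𝓝 0) ∧
        ∀ᶠ N in l, (X N ω).ofLp = A N ω *ᵥ (y N ω).ofLp + b N ω) :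
    TendstoInDistribution X atTop id (fun _ => μ) ν := by
  set Z : ℕ → Ω → (Fin n → Fin n → ℝ) × (Fin n → ℝ) := fun N ω => (A N ω, b N ω) with hZ
  have hZm : ∀ N, AEMeasurable (Z N) μ := fun N => (hA N).prodMk (hb N)
  have hZlim : TendstoInMeasure μ Z atTop
      (fun _ => ((1 : Matrix (Fin n) (Fin n) ℝ), (0 : Fin n → ℝ))) := by
    refine tendstoInMeasure_of_subseq hd_int hd (fun N => (hZm N).aestronglyMeasurable) ?_
    filter_upwards [hlim] with ω hω ns hns hdω
    obtain ⟨h1, h2, -⟩ := hω (map ns atTop) hns.tendsto_atTop (tendsto_map'_iff.2 hdω)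
    exact (tendsto_map'_iff.1 h1).prodMk_nhds (tendsto_map'_iff.1 h2)
  set g : EuclideanSpace ℝ (Fin n) × ((Fin n → Fin n → ℝ) × (Fin n → ℝ)) →
      EuclideanSpace ℝ (Fin n) :=
    fun p => WithLp.toLp 2 (Matrix.of p.2.1 *ᵥ p.1.ofLp + p.2.2) with hg
  have hgc : Continuous g := by
    have h1 : Continuous fun p : EuclideanSpace ℝ (Fin n) ×
        ((Fin n → Fin n → ℝ) × (Fin n → ℝ)) => Matrix.of p.2.1 *ᵥ p.1.ofLp :=
      Continuous.matrix_mulVec (A := fun p : EuclideanSpace ℝ (Fin n) ×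
        ((Fin n → Fin n → ℝ) × (Fin n → ℝ)) => Matrix.of p.2.1)
        (continuous_fst.comp continuous_snd)
        ((PiLp.continuous_ofLp 2 _).comp continuous_fst)
    exact (PiLp.continuous_toLp 2 _).comp (h1.add (continuous_snd.comp continuous_snd))
  have hmain := hy.continuous_comp_prodMk_of_tendstoInMeasure_const hgc hZlim hZm
  have hid : (fun ω : EuclideanSpace ℝ (Fin n) =>
      g (id ω, ((1 : Matrix (Fin n) (Fin n) ℝ), (0 : Fin n → ℝ)))) = id := by
    funext x
    change WithLp.toLp 2 ((1 : Matrix (Fin n) (Fin n) ℝ) *ᵥ x.ofLp + 0) = x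
    simp
  rw [hid] at hmain
  refine tendstoInDistribution_of_tendstoInMeasure_sub X _ hmain ?_ hX
  refine tendstoInMeasure_of_subseq hd_int hd (fun N => ?_) ?_
  · exact ((hX N).sub (hmain.forall_aemeasurable N)).aestronglyMeasurable
  · filter_upwards [hlim] with ω hω ns hns hdω
    obtain ⟨-, -, h3⟩ := hω (map ns atTop) hns.tendsto_atTop (tendsto_map'_iff.2 hdω)
    refine tendsto_const_nhds.congr' ?_
    filter_upwards [eventually_map.1 h3] with k hk
    change (0 : EuclideanSpace ℝ (Fin n)) = X (ns k) ω -
      WithLp.toLp 2 (A (ns k) ω *ᵥ (y (ns k) ω).ofLp + b (ns k) ω)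
    rw [← hk]
    simp

end Slutsky

section Kernel

variable {n p : ℕ} {Θ : Set (EuclideanSpace ℝ (Fin p))}
  {P : EuclideanSpace ℝ (Fin p) → Matrix (Fin n) (Fin n) ℝ}

/-- On a compact set the inverse of a continuous positive definite matrix is bounded. -/
lemma exists_bound_inv (hΘ : IsCompact Θ) (hP_pos : ∀ η ∈ Θ, (P η).PosDef)
    (hP : ∀ i j, ContinuousOn (fun η => P η i j) Θ) :
    ∃ C : ℝ, ∀ η ∈ Θ, ∀ i j, |(P η)⁻¹ i j| ≤ C := by
  have hPc : ContinuousOn P Θ := continuousOn_pi.2 fun i => continuousOn_pi.2 fun j => hP i j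
  have hinv : ContinuousOn (fun η => (P η)⁻¹) Θ := fun η hη =>
    tendsto_matrix_inv (hP_pos η hη).det_pos.ne' (hPc η hη)
  have hsum : ContinuousOn (fun η => ∑ i, ∑ j, |(P η)⁻¹ i j|) Θ :=
    continuousOn_finsetSum _ fun i _ => continuousOn_finsetSum _ fun j _ =>
      (continuousOn_pi.1 (continuousOn_pi.1 hinv i) j).abs
  obtain ⟨C, hC⟩ := hΘ.exists_bound_of_continuousOn hsum
  refine ⟨C, fun η hη i j => ?_⟩
  refine le_trans ?_ ((le_abs_self _).trans (hC η hη))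
  refine le_trans ?_ (Finset.single_le_sum (f := fun i => ∑ j, |(P η)⁻¹ i j|)
    (fun i _ => Finset.sum_nonneg fun j _ => abs_nonneg _) (Finset.mem_univ i))
  exact Finset.single_le_sum (f := fun j => |(P η)⁻¹ i j|) (fun j _ => abs_nonneg _)
    (Finset.mem_univ j)

lemma aemeasurable_kernel (hΘ : IsCompact Θ) (hP : ∀ i j, ContinuousOn (fun η => P η i j) Θ)
    {η : Ω → EuclideanSpace ℝ (Fin p)} (hη : Measurable η) (hη_mem : ∀ᵐ ω ∂μ, η ω ∈ Θ) :
    AEMeasurable (fun ω => P (η ω)) μ := by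
  classical
  refine aemeasurable_matrix fun i j => ?_
  have hm : Measurable (Θ.piecewise (fun η => P η i j) fun _ => 0) :=
    (hP i j).measurable_piecewise continuousOn_const hΘ.measurableSet
  refine ⟨_, hm.comp hη, ?_⟩
  filter_upwards [hη_mem] with ω hω
  simp [Set.piecewise, hω]

end Kernel

section Regression

variable {n : ℕ} {e : ℤ → Ω → ℝ} {v : ℕ → Ω → ℝ} {h : ℕ → ℝ} {s m s' m' : ℝ}

lemma output_eq (u : ℤ → ℝ) (v : ℕ → ℝ) (θ : EuclideanSpace ℝ (Fin n)) (N : ℕ) :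
    output u v θ N = regMatrix u n N *ᵥ θ.ofLp + fun t : Fin N => v (t + 1) := by
  funext t
  simp only [output, regMatrix, mulVec, dotProduct, Pi.add_apply, Matrix.of_apply]
  congr 1
  exact Finset.sum_congr rfl fun i _ => mul_comm _ _

lemma gram_regMatrix (u : ℤ → ℝ) (N : ℕ) (i j : Fin n) :
    gram (regMatrix u n N) i j =
      (N : ℝ)⁻¹ * ∑ t ∈ Finset.range N, u (t + -(i : ℤ)) * u (t + -(j : ℤ)) := by
  rw [Finset.sum_range]
  simp only [gram, Matrix.smul_apply, mul_apply, transpose_apply, regMatrix, Matrix.of_apply,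
    smul_eq_mul]
  congr 1
  exact Finset.sum_congr rfl fun t _ => by congr 2 <;> ring

lemma score_regMatrix (u : ℤ → ℝ) (w : ℕ → ℝ) (N : ℕ) (i : Fin n) :
    score (regMatrix u n N) (fun t : Fin N => w t) i =
      (N : ℝ)⁻¹ * ∑ t ∈ Finset.range N, u (t + -(i : ℤ)) * w t := by
  rw [Finset.sum_range]
  simp only [score, Pi.smul_apply, mulVec, dotProduct, transpose_apply, regMatrix, Matrix.of_apply,
    smul_eq_mul]
  congr 1
  exact Finset.sum_congr rfl fun t _ => by congr 2; ring

lemma indepFun_input {w : ℕ → Ω → ℝ}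
    (hew : IndepFun (fun ω (t : ℤ) => e t ω) (fun ω (t : ℕ) => w t ω) μ) (h : ℕ → ℝ)
    {E : Type*} [MeasurableSpace E] {f : (ℤ → ℝ) → E} (hf : Measurable f) :
    IndepFun (fun ω => f fun t => input h e t ω) (fun ω (t : ℕ) => w t ω) μ := by
  have hG : Measurable fun (x : ℤ → ℝ) (t : ℤ) => ∑' k : ℕ, h k * x (t - k) :=
    measurable_pi_lambda _ fun t => Measurable.tsum fun k => (measurable_pi_apply _).const_mul _
  exact hew.comp (hf.comp hG) measurable_id

variable [IsProbabilityMeasure μ]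

lemma IsWhiteNoise.inputCov_eq (he : IsWhiteNoise e μ s m) (hh : Summable fun k => |h k|)
    (i j : Fin n) : inputCov μ (input h e) n i j =
      ∫ ω, input h e (-(i : ℤ)) ω * input h e (-(j : ℤ)) ω ∂μ := by
  have h2 : ∀ t, MemLp (input h e t) 2 μ := fun t =>
    (he.memLp_input hh t).mono_exponent (by norm_num)
  rw [he.integral_input_mul_neg hh]
  simp only [inputCov, Matrix.of_apply]
  rw [covariance_eq_sub (h2 _) (h2 _), he.integral_input hh, zero_mul, sub_zero]
  rfl

lemma IsWhiteNoise.integrable_input_mul (he : IsWhiteNoise e μ s m)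
    (hh : Summable fun k => |h k|) (a b : ℤ) :
    Integrable (fun ω => input h e a ω * input h e b ω) μ :=
  (memLp_two_mul (he.memLp_input hh a) (he.memLp_input hh b)).integrable (by norm_num)

lemma IsWhiteNoise.integrable_gram (he : IsWhiteNoise e μ s m) (hh : Summable fun k => |h k|)
    (N : ℕ) (i j : Fin n) :
    Integrable (fun ω => gram (regMatrix (fun t => input h e t ω) n N) i j) μ := by
  simp_rw [gram_regMatrix]
  exact (integrable_finsetSum _ fun t _ => he.integrable_input_mul hh _ _).const_mul _

/-- Law of large numbers for the normalized Gram matrix. -/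
lemma IsWhiteNoise.tendsto_gram (he : IsWhiteNoise e μ s m) (hh : Summable fun k => |h k|)
    (i j : Fin n) : Tendsto (fun N => ∫ ω, |gram (regMatrix (fun t => input h e t ω) n N) i j -
      inputCov μ (input h e) n i j| ∂μ) atTop (𝓝 0) := by
  refine (he.tendsto_average_input_mul hh (-(i : ℤ)) (-(j : ℤ))).congr' ?_
  filter_upwards [eventually_gt_atTop 0] with N hN
  have hN' : (N : ℝ) ≠ 0 := by exact_mod_cast hN.ne'
  refine integral_congr_ae (ae_of_all _ fun ω => ?_)
  dsimp only
  rw [gram_regMatrix, he.inputCov_eq hh, Finset.sum_sub_distrib, Finset.sum_const,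
    Finset.card_range, nsmul_eq_mul, mul_sub, inv_mul_cancel_left₀ hN']

end Regression

end

section

variable {Ω : Type*} [MeasurableSpace Ω] {μ : Measure Ω} [IsProbabilityMeasure μ]

section Score

variable {n : ℕ} {e : ℤ → Ω → ℝ} {w : ℕ → Ω → ℝ} {h : ℕ → ℝ} {s m s' m' : ℝ}

lemma IsWhiteNoise.integrable_score (he : IsWhiteNoise e μ s m) (hh : Summable fun k => |h k|)
    (hw : IsWhiteNoise w μ s' m') (N : ℕ) (i : Fin n) :
    Integrable (fun ω => score (regMatrix (fun t => input h e t ω) n N)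
      (fun t : Fin N => w t ω) i) μ := by
  have hrw : ∀ ω, _ := fun ω => score_regMatrix (fun t => input h e t ω) (fun t => w t ω) N i
  simp_rw [hrw]
  exact (integrable_finsetSum _ fun t _ =>
    (memLp_two_mul (he.memLp_input hh _) (hw.memLp t)).integrable (by norm_num)).const_mul _

/-- Law of large numbers for the normalized score. -/
lemma IsWhiteNoise.tendsto_score (he : IsWhiteNoise e μ s m) (hh : Summable fun k => |h k|)
    (hw : IsWhiteNoise w μ s' m')
    (hew : IndepFun (fun ω (t : ℤ) => e t ω) (fun ω (t : ℕ) => w t ω) μ) (i : Fin n) :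
    Tendsto (fun N => ∫ ω, |score (regMatrix (fun t => input h e t ω) n N)
      (fun t : Fin N => w t ω) i| ∂μ) atTop (𝓝 0) := by
  obtain ⟨C, hC, hle⟩ := he.exists_eLpNorm_input_le hh
  have hrw : ∀ (N : ℕ) ω, _ := fun N ω =>
    score_regMatrix (fun t => input h e t ω) (fun t => w t ω) N i
  simp_rw [hrw]
  refine tendsto_integral_abs_average
    (fun t => memLp_two_mul (he.memLp_input hh _) (hw.memLp t))
    (K := 2⁻¹ * C.toReal ^ 4 + 2⁻¹ * m') (fun t => ?_) fun t t' htt' => ?_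
  · have hu := he.memLp_input hh (t + -(i : ℤ))
    have hu4 : Integrable (fun ω => input h e (t + -(i : ℤ)) ω ^ 4) μ := by
      refine (hu.integrable_norm_pow (by norm_num)).congr (ae_of_all _ fun ω => ?_)
      simp only [Real.norm_eq_abs]
      exact Even.pow_abs (by decide) _
    have hw4 := hw.integrable_pow_four t
    calc ∫ ω, (input h e (t + -(i : ℤ)) ω * w t ω) ^ 2 ∂μ
        ≤ ∫ ω, (2⁻¹ * input h e (t + -(i : ℤ)) ω ^ 4 + 2⁻¹ * w t ω ^ 4) ∂μ := by
          refine integral_mono (memLp_two_mul hu (hw.memLp t)).integrable_sq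
            ((hu4.const_mul _).add (hw4.const_mul _)) fun ω => ?_
          change (input h e (t + -(i : ℤ)) ω * w t ω) ^ 2 ≤
            2⁻¹ * input h e (t + -(i : ℤ)) ω ^ 4 + 2⁻¹ * w t ω ^ 4
          nlinarith [sq_nonneg (input h e (t + -(i : ℤ)) ω ^ 2 - w t ω ^ 2)]
      _ ≤ 2⁻¹ * C.toReal ^ 4 + 2⁻¹ * m' := by
          rw [integral_add (hu4.const_mul _) (hw4.const_mul _), integral_const_mul,
            integral_const_mul, hw.fourth]
          have := integral_pow_four_le hu hC (hle _)
          linarith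
  · have hind := (indepFun_input hew h
      (f := fun x => x (t + -(i : ℤ)) * x (t' + -(i : ℤ))) (by fun_prop)).comp
      (φ := id) (ψ := fun y : ℕ → ℝ => y t * y t') measurable_id (by fun_prop)
    have hprod := IndepFun.integral_fun_mul_eq_mul_integral (𝕜 := ℝ) hind
      (he.integrable_input_mul hh _ _).aestronglyMeasurable
      (hw.integrable_mul t t').aestronglyMeasurable
    simp only [Function.comp_def, hw.integral_mul, htt'.ne, if_false, mul_zero] at hprod
    rw [← hprod]
    exact integral_congr_ae (ae_of_all _ fun ω => by simp only [id]; ring)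

/-- The distance of the normalized sample moments to their limits. -/
def momentError (S : Matrix (Fin n) (Fin n) ℝ) (s : ℝ) {N : ℕ} (Φ : Matrix (Fin N) (Fin n) ℝ)
    (V : Fin N → ℝ) : ℝ :=
  ∑ i, ∑ j, |gram Φ i j - S i j| + ∑ i, |score Φ V i| + |(N : ℝ)⁻¹ * ∑ t, V t ^ 2 - s|

lemma tendsto_of_momentError {S : Matrix (Fin n) (Fin n) ℝ} {s : ℝ} {l : Filter ℕ}
    {Φ : (N : ℕ) → Matrix (Fin N) (Fin n) ℝ} {V : (N : ℕ) → Fin N → ℝ}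
    (hd : Tendsto (fun N => momentError S s (Φ N) (V N)) l (𝓝 0)) :
    Tendsto (fun N => gram (Φ N)) l (𝓝 S) ∧ Tendsto (fun N => score (Φ N) (V N)) l (𝓝 0) ∧
      Tendsto (fun N : ℕ => (N : ℝ)⁻¹ * ∑ t, V N t ^ 2) l (𝓝 s) := by
  have h1 : ∀ N, 0 ≤ ∑ i, ∑ j, |gram (Φ N) i j - S i j| := fun N =>
    Finset.sum_nonneg fun i _ => Finset.sum_nonneg fun j _ => abs_nonneg _
  have h2 : ∀ N, 0 ≤ ∑ i, |score (Φ N) (V N) i| := fun N =>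
    Finset.sum_nonneg fun i _ => abs_nonneg _
  have h3 : ∀ N : ℕ, 0 ≤ |(N : ℝ)⁻¹ * ∑ t, V N t ^ 2 - s| := fun N => abs_nonneg _
  refine ⟨tendsto_pi_nhds.2 fun i => tendsto_pi_nhds.2 fun j => ?_,
    tendsto_pi_nhds.2 fun i => ?_, ?_⟩
  · rw [tendsto_iff_norm_sub_tendsto_zero]
    refine squeeze_zero (fun N => norm_nonneg _) (fun N => ?_) hd
    have hi := Finset.single_le_sum (f := fun i => ∑ j, |gram (Φ N) i j - S i j|)
      (fun i _ => Finset.sum_nonneg fun j _ => abs_nonneg _) (Finset.mem_univ i)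
    have hj := Finset.single_le_sum (f := fun j => |gram (Φ N) i j - S i j|)
      (fun j _ => abs_nonneg _) (Finset.mem_univ j)
    have := h2 N
    have := h3 N
    simp only [momentError, Real.norm_eq_abs] at *
    linarith
  · refine squeeze_zero_norm (fun N => ?_) hd
    have hi := Finset.single_le_sum (f := fun i => |score (Φ N) (V N) i|)
      (fun i _ => abs_nonneg _) (Finset.mem_univ i)
    have := h1 N
    have := h3 N
    simp only [momentError, Real.norm_eq_abs] at *
    linarith
  · rw [tendsto_iff_norm_sub_tendsto_zero]
    refine squeeze_zero (fun N => norm_nonneg _) (fun N => ?_) hd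
    have := h1 N
    have := h2 N
    simp only [momentError, Real.norm_eq_abs] at *
    linarith

lemma IsWhiteNoise.integrable_momentError (he : IsWhiteNoise e μ s m)
    (hh : Summable fun k => |h k|) (hw : IsWhiteNoise w μ s' m') (N : ℕ) :
    Integrable (fun ω => momentError (inputCov μ (input h e) n) s'
      (regMatrix (fun t => input h e t ω) n N) fun t : Fin N => w t ω) μ := by
  refine ((integrable_finsetSum _ fun i _ => integrable_finsetSum _ fun j _ =>
    ((he.integrable_gram hh N i j).sub (integrable_const _)).abs).add
    (integrable_finsetSum _ fun i _ => (he.integrable_score hh hw N i).abs)).add ?_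
  exact (((integrable_finsetSum _ fun t _ => (hw.memLp_two _).integrable_sq).const_mul _).sub
    (integrable_const _)).abs

lemma IsWhiteNoise.tendsto_momentError (he : IsWhiteNoise e μ s m)
    (hh : Summable fun k => |h k|) (hw : IsWhiteNoise w μ s' m')
    (hew : IndepFun (fun ω (t : ℤ) => e t ω) (fun ω (t : ℕ) => w t ω) μ) :
    Tendsto (fun N => ∫ ω, |momentError (inputCov μ (input h e) n) s'
      (regMatrix (fun t => input h e t ω) n N) fun t : Fin N => w t ω| ∂μ) atTop (𝓝 0) := by
  have hsq : Tendsto (fun N : ℕ => ∫ ω, |(N : ℝ)⁻¹ * ∑ t : Fin N, w t ω ^ 2 - s'| ∂μ) atTop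
      (𝓝 0) := by
    refine (hw.tendsto_average_sq (f := id) Function.injective_id).congr' ?_
    filter_upwards [eventually_gt_atTop 0] with N hN
    have hN' : (N : ℝ) ≠ 0 := by exact_mod_cast hN.ne'
    refine integral_congr_ae (ae_of_all _ fun ω => ?_)
    dsimp only [id]
    rw [Finset.sum_sub_distrib, Finset.sum_const, Finset.card_range, nsmul_eq_mul, mul_sub,
      inv_mul_cancel_left₀ hN', Finset.sum_range]
  have hsum := ((tendsto_finsetSum Finset.univ fun i _ => tendsto_finsetSum Finset.univ
    fun j _ => he.tendsto_gram (n := n) hh i j).add (tendsto_finsetSum Finset.univ fun i _ =>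
      he.tendsto_score (n := n) hh hw hew i)).add hsq
  simp only [Finset.sum_const_zero, add_zero] at hsum
  refine hsum.congr fun N => ?_
  have hg : ∀ i j : Fin n, Integrable (fun ω =>
      |gram (regMatrix (fun t => input h e t ω) n N) i j - inputCov μ (input h e) n i j|) μ :=
    fun i j => ((he.integrable_gram hh N i j).sub (integrable_const _)).abs
  have h1 : Integrable (fun ω => ∑ i, ∑ j,
      |gram (regMatrix (fun t => input h e t ω) n N) i j - inputCov μ (input h e) n i j|) μ :=
    integrable_finsetSum _ fun i _ => integrable_finsetSum _ fun j _ => hg i j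
  have h2 : Integrable (fun ω => ∑ i, |score (regMatrix (fun t => input h e t ω) n N)
      (fun t : Fin N => w t ω) i|) μ :=
    integrable_finsetSum _ fun i _ => (he.integrable_score hh hw N i).abs
  have h3 : Integrable (fun ω => |(N : ℝ)⁻¹ * ∑ t : Fin N, w t ω ^ 2 - s'|) μ :=
    (((integrable_finsetSum _ fun t _ => (hw.memLp_two _).integrable_sq).const_mul _).sub
      (integrable_const _)).abs
  have habs : ∀ ω, |momentError (inputCov μ (input h e) n) s'
      (regMatrix (fun t => input h e t ω) n N) fun t : Fin N => w t ω| =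
      ∑ i, ∑ j, |gram (regMatrix (fun t => input h e t ω) n N) i j -
        inputCov μ (input h e) n i j| + ∑ i, |score (regMatrix (fun t => input h e t ω) n N)
      (fun t : Fin N => w t ω) i| + |(N : ℝ)⁻¹ * ∑ t : Fin N, w t ω ^ 2 - s'| := fun ω =>
    abs_of_nonneg (by unfold momentError; positivity)
  simp_rw [habs]
  have h12 : Integrable (fun ω => ∑ i, ∑ j,
      |gram (regMatrix (fun t => input h e t ω) n N) i j - inputCov μ (input h e) n i j| +
      ∑ i, |score (regMatrix (fun t => input h e t ω) n N) (fun t : Fin N => w t ω) i|) μ :=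
    h1.add h2
  rw [integral_add h12 h3, integral_add h1 h2]
  congr 2
  · rw [integral_finsetSum _ fun i _ => integrable_finsetSum _ fun j _ => hg i j]
    exact Finset.sum_congr rfl fun i _ => (integral_finsetSum _ fun j _ => hg i j).symm
  · rw [integral_finsetSum _ fun i _ => (he.integrable_score hh hw N i).abs]

/-- Convergence of the characteristic functions of the rescaled score. -/
lemma IsWhiteNoise.tendsto_integral_exp_score (he : IsWhiteNoise e μ s m)
    (hh : Summable fun k => |h k|) (hw : IsWhiteNoise w μ s' m')
    (hw_ident : ∀ t t', IdentDistrib (w t) (w t') μ μ)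
    (hew : IndepFun (fun ω (t : ℤ) => e t ω) (fun ω (t : ℕ) => w t ω) μ)
    (hS : (inputCov μ (input h e) n).PosSemidef) (a : Fin n → ℝ) :
    Tendsto (fun N : ℕ => ∫ ω, Complex.exp ((√(N : ℝ) *
      (a ⬝ᵥ score (regMatrix (fun t => input h e t ω) n N) fun t : Fin N => w t ω) : ℝ) *
        Complex.I) ∂μ) atTop
      (𝓝 (Real.exp (-(s' * (a ⬝ᵥ inputCov μ (input h e) n *ᵥ a) / 2)) : ℂ)) := by
  obtain ⟨C, hC, hle⟩ := he.exists_eLpNorm_input_le hh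
  set S := inputCov μ (input h e) n with hSdef
  set x : ℕ → Ω → ℝ := fun t ω => ∑ i : Fin n, a i * input h e (t + -(i : ℤ)) ω with hx
  have hxm : ∀ t, Measurable (x t) := fun t =>
    Finset.measurable_fun_sum _ fun i _ => (he.measurable_input h _).const_mul _
  have hxL : ∀ t, MemLp (x t) 4 μ := fun t =>
    memLp_finsetSum _ fun i _ => (he.memLp_input hh _).const_mul _
  have hx4 : ∀ t, Integrable (fun ω => x t ω ^ 4) μ := fun t => by
    refine ((hxL t).integrable_norm_pow (by norm_num)).congr (ae_of_all _ fun ω => ?_)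
    simp only [Real.norm_eq_abs]
    exact Even.pow_abs (by decide) _
  have hD : ∑ i : Fin n, ‖a i‖ₑ * C ≠ ⊤ :=
    ENNReal.sum_ne_top.2 fun i _ => ENNReal.mul_ne_top enorm_ne_top hC
  have hxle : ∀ t, eLpNorm (x t) 4 μ ≤ ∑ i : Fin n, ‖a i‖ₑ * C := fun t => by
    have : x t = ∑ i : Fin n, a i • input h e (t + -(i : ℤ)) := by
      funext ω
      simp [hx]
    rw [this]
    refine (eLpNorm_sum_le (fun i _ => ((he.measurable_input h _).const_smul
      (a i)).aestronglyMeasurable) (by norm_num)).trans (Finset.sum_le_sum fun i _ => ?_)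
    rw [eLpNorm_const_smul]
    gcongr
    exact hle _
  have hind : IndepFun (fun ω t => x t ω) (fun ω t => w t ω) μ :=
    indepFun_input hew h (f := fun y (t : ℕ) => ∑ i : Fin n, a i * y (t + -(i : ℤ)))
      (by fun_prop)
  have hquad : ∀ (N : ℕ) ω, (N : ℝ)⁻¹ * ∑ t ∈ Finset.range N, x t ω ^ 2 - a ⬝ᵥ S *ᵥ a =
      ∑ i, ∑ j, a i * a j *
        (gram (regMatrix (fun t => input h e t ω) n N) i j - S i j) := by
    intro N ω
    have h1 : (N : ℝ)⁻¹ * ∑ t ∈ Finset.range N, x t ω ^ 2 =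
        ∑ i, ∑ j, a i * a j * gram (regMatrix (fun t => input h e t ω) n N) i j := by
      simp_rw [gram_regMatrix, hx, sq, Finset.sum_mul_sum, Finset.mul_sum]
      rw [Finset.sum_comm]
      refine Finset.sum_congr rfl fun i _ => ?_
      rw [Finset.sum_comm]
      exact Finset.sum_congr rfl fun j _ => Finset.sum_congr rfl fun t _ => by ring
    have h2 : a ⬝ᵥ S *ᵥ a = ∑ i, ∑ j, a i * a j * S i j := by
      simp only [dotProduct, mulVec, Finset.mul_sum]
      exact Finset.sum_congr rfl fun i _ => Finset.sum_congr rfl fun j _ => by ring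
    rw [h1, h2]
    simp_rw [mul_sub, Finset.sum_sub_distrib]
  have hlim : Tendsto (fun N : ℕ =>
      ∫ ω, |(N : ℝ)⁻¹ * ∑ t ∈ Finset.range N, x t ω ^ 2 - a ⬝ᵥ S *ᵥ a| ∂μ) atTop (𝓝 0) := by
    have hsum := tendsto_finsetSum Finset.univ fun (i : Fin n) _ =>
      tendsto_finsetSum Finset.univ fun (j : Fin n) _ =>
        (he.tendsto_gram hh i j).const_mul |a i * a j|
    simp only [mul_zero, Finset.sum_const_zero] at hsum
    refine squeeze_zero (fun N => integral_nonneg fun _ => abs_nonneg _) (fun N => ?_) hsum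
    have hi : ∀ i j : Fin n, Integrable (fun ω => |a i * a j| *
        |gram (regMatrix (fun t => input h e t ω) n N) i j - S i j|) μ := fun i j =>
      ((he.integrable_gram hh N i j).sub (integrable_const _)).abs.const_mul _
    have hval : ∑ i, ∑ j, |a i * a j| *
        ∫ ω, |gram (regMatrix (fun t => input h e t ω) n N) i j - S i j| ∂μ =
        ∫ ω, ∑ i, ∑ j, |a i * a j| *
          |gram (regMatrix (fun t => input h e t ω) n N) i j - S i j| ∂μ := by
      rw [integral_finsetSum _ fun i _ => integrable_finsetSum _ fun j _ => hi i j]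
      refine Finset.sum_congr rfl fun i _ => ?_
      rw [integral_finsetSum _ fun j _ => hi i j]
      exact Finset.sum_congr rfl fun j _ => (integral_const_mul _ _).symm
    rw [hval]
    refine integral_mono_of_nonneg (ae_of_all _ fun ω => abs_nonneg _)
      (integrable_finsetSum _ fun i _ => integrable_finsetSum _ fun j _ => hi i j)
      (ae_of_all _ fun ω => ?_)
    dsimp only
    rw [hquad]
    refine (Finset.abs_sum_le_sum_abs _ _).trans (Finset.sum_le_sum fun i _ => ?_)
    refine (Finset.abs_sum_le_sum_abs _ _).trans (Finset.sum_le_sum fun j _ => ?_)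
    rw [abs_mul]
  have hq : 0 ≤ a ⬝ᵥ S *ᵥ a := by simpa using hS.dotProduct_mulVec_nonneg a
  have hclt := tendsto_integral_exp_weighted_sum hxm hw.measurable hind hw.indep hw_ident
    ((hw.memLp 0).mono_exponent (by norm_num)) (hw.mean 0) (hw.second 0) hx4
    (fun t => integral_pow_four_le (hxL t) hD (hxle t)) hq hlim
  refine hclt.congr fun N => integral_congr_ae (ae_of_all _ fun ω => ?_)
  dsimp only
  congr 3
  simp only [dotProduct, score_regMatrix (fun t => input h e t ω) (fun t => w t ω)]
  have hN : √(N : ℝ) * (N : ℝ)⁻¹ = (√(N : ℝ))⁻¹ := by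
    rcases Nat.eq_zero_or_pos N with rfl | hN
    · simp
    · have : (0 : ℝ) < N := by exact_mod_cast hN
      have h2 := Real.mul_self_sqrt this.le
      field_simp
      rw [sq, h2]
  simp only [hx, Finset.sum_mul, Finset.mul_sum]
  rw [Finset.sum_comm]
  refine Finset.sum_congr rfl fun i _ => Finset.sum_congr rfl fun t _ => ?_
  rw [← hN]
  ring

end Score

end

section

variable {Ω : Type*} [MeasurableSpace Ω] {μ : Measure Ω}

section Estimators

variable {n p : ℕ} {e : ℤ → Ω → ℝ} {w : ℕ → Ω → ℝ} {h : ℕ → ℝ} {s m σ m' : ℝ}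

lemma IsWhiteNoise.aemeasurable_regMatrix (he : IsWhiteNoise e μ s m) (h : ℕ → ℝ) (N : ℕ) :
    AEMeasurable (fun ω => regMatrix (fun t => input h e t ω) n N) μ :=
  aemeasurable_matrix fun _ _ => (he.measurable_input h _).aemeasurable

variable [IsProbabilityMeasure μ]

/-- Asymptotic normality of the rescaled score, premultiplied by the inverse covariance. -/
lemma IsWhiteNoise.tendstoInDistribution_score (he : IsWhiteNoise e μ s m)
    (hh : Summable fun k => |h k|) (hw : IsWhiteNoise w μ (σ ^ 2) m')
    (hw_ident : ∀ t t', IdentDistrib (w t) (w t') μ μ)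
    (hew : IndepFun (fun ω (t : ℤ) => e t ω) (fun ω (t : ℕ) => w t ω) μ)
    (hS : (inputCov μ (input h e) n).PosDef) :
    TendstoInDistribution (fun (N : ℕ) ω => (WithLp.toLp 2 ((inputCov μ (input h e) n)⁻¹ *ᵥ
      (√(N : ℝ) • score (regMatrix (fun t => input h e t ω) n N) fun t : Fin N => w t ω)) :
        EuclideanSpace ℝ (Fin n)))
      atTop id (fun _ => μ) (multivariateGaussian 0 (σ ^ 2 • (inputCov μ (input h e) n)⁻¹)) := by
  set S := inputCov μ (input h e) n with hSdef
  have hm : ∀ N : ℕ, AEMeasurable (fun ω => (WithLp.toLp 2 (S⁻¹ *ᵥ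
      (√(N : ℝ) • score (regMatrix (fun t => input h e t ω) n N) fun t : Fin N => w t ω)) :
        EuclideanSpace ℝ (Fin n))) μ := fun N => by
    refine (WithLp.measurable_toLp 2 _).comp_aemeasurable
      (aemeasurable_mulVec aemeasurable_const ?_)
    exact aemeasurable_pi_lambda _ fun i =>
      (he.integrable_score hh hw N i).aemeasurable.const_mul _
  refine ⟨hm, aemeasurable_id, ?_⟩
  refine ProbabilityMeasure.tendsto_iff_tendsto_charFun.2 fun t => ?_
  have hpsd : (σ ^ 2 • S⁻¹).PosSemidef := hS.inv.posSemidef.smul (sq_nonneg σ)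
  have hsymm : S⁻¹.IsSymm := by simpa using hS.inv.isHermitian
  have hdet : IsUnit S.det := isUnit_iff_ne_zero.2 hS.det_pos.ne'
  simp only [ProbabilityMeasure.coe_mk, Measure.map_id]
  rw [charFun_multivariateGaussian hpsd]
  have hlim := he.tendsto_integral_exp_score hh hw hw_ident hew hS.posSemidef (S⁻¹ *ᵥ t.ofLp)
  have hval : Complex.exp (((inner ℝ t 0 : ℝ) : ℂ) * Complex.I -
      ((t.ofLp ⬝ᵥ (σ ^ 2 • S⁻¹) *ᵥ t.ofLp : ℝ) : ℂ) / 2) =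
      (Real.exp (-(σ ^ 2 * ((S⁻¹ *ᵥ t.ofLp) ⬝ᵥ S *ᵥ (S⁻¹ *ᵥ t.ofLp)) / 2)) : ℂ) := by
    rw [mulVec_mulVec, mul_nonsing_inv _ hdet, one_mulVec, smul_mulVec, dotProduct_smul,
      dotProduct_comm (S⁻¹ *ᵥ t.ofLp), inner_zero_right, smul_eq_mul]
    push_cast
    congr 1
    ring
  rw [hval]
  refine hlim.congr fun N => ?_
  rw [charFun_apply, integral_map (hm N) (by fun_prop)]
  refine integral_congr_ae (ae_of_all _ fun ω => ?_)
  dsimp only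
  congr 3
  rw [EuclideanSpace.inner_eq_star_dotProduct]
  simp only [star_trivial]
  rw [dotProduct_mulVec, ← mulVec_transpose, hsymm.eq, dotProduct_smul, smul_eq_mul]

/-- Asymptotic normality of the least squares estimator. -/
lemma IsWhiteNoise.tendstoInDistribution_lsEstimator (he : IsWhiteNoise e μ s m)
    (hh : Summable fun k => |h k|) (hw : IsWhiteNoise w μ (σ ^ 2) m')
    (hw_ident : ∀ t t', IdentDistrib (w t) (w t') μ μ)
    (hew : IndepFun (fun ω (t : ℤ) => e t ω) (fun ω (t : ℕ) => w t ω) μ)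
    (hS : (inputCov μ (input h e) n).PosDef) (θ : EuclideanSpace ℝ (Fin n)) :
    TendstoInDistribution (fun (N : ℕ) ω => √(N : ℝ) •
      (lsEstimator (regMatrix (fun t => input h e t ω) n N)
        (regMatrix (fun t => input h e t ω) n N *ᵥ θ.ofLp + fun t : Fin N => w t ω) - θ))
      atTop id (fun _ => μ) (multivariateGaussian 0 (σ ^ 2 • (inputCov μ (input h e) n)⁻¹)) := by
  have hΦ := fun N => he.aemeasurable_regMatrix (n := n) h N
  have hY : ∀ N : ℕ, AEMeasurable (fun ω =>
      regMatrix (fun t => input h e t ω) n N *ᵥ θ.ofLp + fun t : Fin N => w t ω) μ := fun N =>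
    (aemeasurable_mulVec (hΦ N) aemeasurable_const).add
      (aemeasurable_pi_lambda _ fun t => (hw.measurable t).aemeasurable)
  have hdet := hS.det_pos.ne'
  have hgram : ∀ N : ℕ, AEMeasurable
      (fun ω => gram (regMatrix (fun t => input h e t ω) n N)) μ := fun N =>
    aemeasurable_matrix fun i j => (he.integrable_gram hh N i j).aemeasurable
  refine tendstoInDistribution_of_perturbation
    (he.tendstoInDistribution_score hh hw hw_ident hew hS)
    (he.integrable_momentError (n := n) hh hw)
    (he.tendsto_momentError (n := n) hh hw hew)
    (A := fun N ω => (gram (regMatrix (fun t => input h e t ω) n N))⁻¹ *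
      inputCov μ (input h e) n) (b := fun _ _ => 0)
    (fun N => aemeasurable_matrix_mul (aemeasurable_matrix_inv (hgram N)) aemeasurable_const)
    (fun N => aemeasurable_const)
    (fun N => ((aemeasurable_lsEstimator (hΦ N) (hY N)).sub_const θ).const_smul (√(N : ℝ)))
    (ae_of_all _ fun ω l hl hd => ?_)
  obtain ⟨hg, -, -⟩ := tendsto_of_momentError hd
  have hinv := tendsto_matrix_inv hdet hg
  refine ⟨?_, tendsto_const_nhds, ?_⟩
  · have := hinv.mul (tendsto_const_nhds (x := inputCov μ (input h e) n))
    rwa [nonsing_inv_mul _ (isUnit_iff_ne_zero.2 hdet)] at this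
  · filter_upwards [eventually_isUnit_det hdet hg] with N hN
    rw [WithLp.ofLp_smul, WithLp.ofLp_sub, lsEstimator_eq hN, add_sub_cancel_left, add_zero,
      mulVec_mulVec, Matrix.mul_assoc, mul_nonsing_inv _ (isUnit_iff_ne_zero.2 hdet),
      Matrix.mul_one, mulVec_smul]

/-- Asymptotic normality of the regularized least squares estimator, for any choice of the
hyper-parameter in a compact set. -/
lemma IsWhiteNoise.tendstoInDistribution_rlsEstimator (he : IsWhiteNoise e μ s m)
    (hh : Summable fun k => |h k|) (hw : IsWhiteNoise w μ (σ ^ 2) m')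
    (hw_ident : ∀ t t', IdentDistrib (w t) (w t') μ μ)
    (hew : IndepFun (fun ω (t : ℤ) => e t ω) (fun ω (t : ℕ) => w t ω) μ) (hσ : 0 < σ)
    (hS : (inputCov μ (input h e) n).PosDef) (θ : EuclideanSpace ℝ (Fin n))
    {Θ : Set (EuclideanSpace ℝ (Fin p))} (hΘ : IsCompact Θ)
    {P : EuclideanSpace ℝ (Fin p) → Matrix (Fin n) (Fin n) ℝ}
    (hP_pos : ∀ η ∈ Θ, (P η).PosDef) (hP : ∀ i j, ContinuousOn (fun η => P η i j) Θ)
    {η : ℕ → Ω → EuclideanSpace ℝ (Fin p)} (hη : ∀ N, Measurable (η N))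
    (hη_mem : ∀ N, ∀ᵐ ω ∂μ, η N ω ∈ Θ) :
    TendstoInDistribution (fun (N : ℕ) ω => √(N : ℝ) •
      (rlsEstimator (regMatrix (fun t => input h e t ω) n N)
        (regMatrix (fun t => input h e t ω) n N *ᵥ θ.ofLp + fun t : Fin N => w t ω)
        (P (η N ω)) - θ))
      atTop id (fun _ => μ) (multivariateGaussian 0 (σ ^ 2 • (inputCov μ (input h e) n)⁻¹)) := by
  set S := inputCov μ (input h e) n with hSdef
  set Φ : (N : ℕ) → Ω → Matrix (Fin N) (Fin n) ℝ :=
    fun N ω => regMatrix (fun t => input h e t ω) n N with hΦdef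
  set V : (N : ℕ) → Ω → Fin N → ℝ := fun N ω t => w t ω with hVdef
  set r : ℕ → Ω → ℝ := fun N ω => noiseVarEst (Φ N ω) (Φ N ω *ᵥ θ.ofLp + V N ω) with hr
  have hΦ : ∀ N, AEMeasurable (Φ N) μ := fun N => he.aemeasurable_regMatrix (n := n) h N
  have hY : ∀ N : ℕ, AEMeasurable (fun ω => Φ N ω *ᵥ θ.ofLp + V N ω) μ := fun N =>
    (aemeasurable_mulVec (hΦ N) aemeasurable_const).add
      (aemeasurable_pi_lambda _ fun t => (hw.measurable t).aemeasurable)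
  have hrm : ∀ N, AEMeasurable (r N) μ := fun N => aemeasurable_noiseVarEst (hΦ N) (hY N)
  have hPm : ∀ N, AEMeasurable (fun ω => P (η N ω)) μ := fun N =>
    aemeasurable_kernel hΘ hP (hη N) (hη_mem N)
  have hdet := hS.det_pos.ne'
  have hgram : ∀ N : ℕ, AEMeasurable (fun ω => gram (Φ N ω)) μ := fun N =>
    aemeasurable_matrix fun i j => (he.integrable_gram hh N i j).aemeasurable
  set B : ℕ → Ω → Matrix (Fin n) (Fin n) ℝ :=
    fun N ω => (gram (Φ N ω) + (r N ω / N) • (P (η N ω))⁻¹)⁻¹ with hB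
  have hBm : ∀ N, AEMeasurable (B N) μ := fun N =>
    aemeasurable_matrix_inv (aemeasurable_matrix_add (hgram N)
      (aemeasurable_matrix_smul ((hrm N).div_const _) (aemeasurable_matrix_inv (hPm N))))
  obtain ⟨C, hC⟩ := exists_bound_inv hΘ hP_pos hP
  refine tendstoInDistribution_of_perturbation
    (he.tendstoInDistribution_score hh hw hw_ident hew hS)
    (he.integrable_momentError (n := n) hh hw)
    (he.tendsto_momentError (n := n) hh hw hew)
    (A := fun N ω => B N ω * S)
    (b := fun N ω => B N ω *ᵥ (((-(√(N : ℝ) * (r N ω / N))) • (P (η N ω))⁻¹) *ᵥ θ.ofLp))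
    (fun N => aemeasurable_matrix_mul (hBm N) aemeasurable_const)
    (fun N => aemeasurable_mulVec (hBm N) (aemeasurable_mulVec (aemeasurable_matrix_smul
      (((hrm N).div_const _).const_mul _).neg (aemeasurable_matrix_inv (hPm N)))
      aemeasurable_const))
    (fun N => ((aemeasurable_rlsEstimator (hΦ N) (hY N) (hPm N)).sub_const θ).const_smul
      (√(N : ℝ))) ?_
  filter_upwards [ae_all_iff.2 hη_mem] with ω hω l hl hd
  obtain ⟨hg, hsc, hsq⟩ := tendsto_of_momentError hd
  have hrlim : Tendsto (fun N => r N ω) l (𝓝 (σ ^ 2)) :=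
    tendsto_noiseVarEst hl hdet θ.ofLp hg hsc hsq
  have hinvN : Tendsto (fun N : ℕ => (N : ℝ)⁻¹) l (𝓝 0) :=
    (tendsto_inv_atTop_nhds_zero_nat (𝕜 := ℝ)).mono_left hl
  have hsqrtN : Tendsto (fun N : ℕ => √(N : ℝ) * (N : ℝ)⁻¹) l (𝓝 0) := by
    have h1 : Tendsto (fun N : ℕ => (√(N : ℝ))⁻¹) l (𝓝 0) :=
      (tendsto_inv_atTop_zero.comp
        (Real.tendsto_sqrt_atTop.comp tendsto_natCast_atTop_atTop)).mono_left hl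
    refine h1.congr fun N => ?_
    rw [← div_eq_mul_inv, Real.sqrt_div_self', one_div]
  have hc1 : Tendsto (fun N : ℕ => r N ω / N) l (𝓝 0) := by
    simpa [div_eq_mul_inv] using hrlim.mul hinvN
  have hc2 : Tendsto (fun N : ℕ => -(√(N : ℝ) * (r N ω / N))) l (𝓝 0) := by
    have := (hrlim.mul hsqrtN).neg
    simp only [mul_zero, neg_zero] at this
    exact this.congr fun N => by ring
  have hbd : ∀ N i j, |(P (η N ω))⁻¹ i j| ≤ C := fun N i j => hC _ (hω N) i j
  have hM : Tendsto (fun N => gram (Φ N ω) + (r N ω / N) • (P (η N ω))⁻¹) l (𝓝 S) := by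
    simpa using hg.add (tendsto_smul_of_bounded hc1 hbd)
  have hinv : Tendsto (fun N => B N ω) l (𝓝 S⁻¹) := tendsto_matrix_inv hdet hM
  refine ⟨?_, ?_, ?_⟩
  · have := hinv.mul (tendsto_const_nhds (x := S))
    rwa [nonsing_inv_mul _ (isUnit_iff_ne_zero.2 hdet)] at this
  · have := tendsto_mulVec hinv (tendsto_mulVec (tendsto_smul_of_bounded hc2 hbd)
      (tendsto_const_nhds (x := θ.ofLp)))
    simpa using this
  · filter_upwards [eventually_isUnit_det hdet hM,
      hrlim.eventually_const_lt (by positivity : (0 : ℝ) < σ ^ 2)] with N hN hpos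
    rw [WithLp.ofLp_smul, WithLp.ofLp_sub, rlsEstimator_eq (hP_pos _ (hω N)) rfl hpos hN,
      add_sub_cancel_left, mulVec_mulVec, Matrix.mul_assoc,
      mul_nonsing_inv _ (isUnit_iff_ne_zero.2 hdet), Matrix.mul_one, ← mulVec_add, ← mulVec_smul,
      smul_sub, smul_smul, smul_mulVec, neg_smul, ← sub_eq_add_neg]

end Estimators

end

end RegFIR

end

theorem proposition2
    {Ω : Type*} [MeasurableSpace Ω] (μ : Measure Ω) [IsProbabilityMeasure μ]
    -- dimensions, the true parameter, the filter, and the two noise processes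
    (n p : ℕ) (θ₀ : EuclideanSpace ℝ (Fin n))
    (h : ℕ → ℝ) (e : ℤ → Ω → ℝ) (v : ℕ → Ω → ℝ) (σe σ : ℝ)
    -- the input is white noise `e` filtered by a stable filter `h`
    (h_stable : Summable fun k => |h k|)
    (he_meas : ∀ t, Measurable (e t))
    (he_indep : iIndepFun e μ)
    (he_ident : ∀ s t, IdentDistrib (e s) (e t) μ μ)
    (he_mean : ∀ t, ∫ ω, e t ω ∂μ = 0)
    (hσe : 0 < σe)
    (he_var : ∀ t, variance (e t) μ = σe ^ 2)
    (he_mom : ∃ δ : ℝ, 0 < δ ∧ ∀ t, MemLp (e t) (ENNReal.ofReal (4 + δ)) μ)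
    (he_fourth : ∃ c : ℝ, 0 < c ∧ ∀ t, ∫ ω, (e t ω) ^ 4 ∂μ = c * σe ^ 4)
    (h_cov : (RegFIR.inputCov μ (RegFIR.input h e) n).PosDef)
    -- the measurement noise `v(1), v(2), …`
    (hv_meas : ∀ t : ℕ, Measurable (v (t + 1)))
    (hv_indep : iIndepFun (fun t : ℕ => v (t + 1)) μ)
    (hv_ident : ∀ s t : ℕ, IdentDistrib (v (s + 1)) (v (t + 1)) μ μ)
    (hv_mean : ∀ t : ℕ, ∫ ω, v (t + 1) ω ∂μ = 0)
    (hσ : 0 < σ)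
    (hv_var : ∀ t : ℕ, variance (v (t + 1)) μ = σ ^ 2)
    (hv_mom : ∃ δ : ℝ, 0 < δ ∧ ∀ t : ℕ, MemLp (v (t + 1)) (ENNReal.ofReal (4 + δ)) μ)
    -- the processes `e` and `v` are independent of each other
    (hev : IndepFun (fun ω (t : ℤ) => e t ω) (fun ω (t : ℕ) => v (t + 1) ω) μ)
    -- the regression matrix has full column rank
    (h_rank : ∀ᵐ ω ∂μ, ∀ᶠ N : ℕ in atTop,
      (RegFIR.regMatrix (fun t => RegFIR.input h e t ω) n N).rank = n)
    -- the compact hyper-parameter set and the kernel matrix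
    (Θ : Set (EuclideanSpace ℝ (Fin p))) (hΘ : IsCompact Θ)
    (P : EuclideanSpace ℝ (Fin p) → Matrix (Fin n) (Fin n) ℝ)
    (hP_pos : ∀ η ∈ Θ, (P η).PosDef)
    (hP_smooth : ∀ i j, ContDiffOn ℝ 2 (fun η => P η i j) Θ)
    -- the limiting minimizers: isolated points, some of them interior
    (h_star_interior : (RegFIR.limitArgmin P θ₀ Θ ∩ interior Θ).Nonempty)
    (h_star_isolated : IsDiscrete (RegFIR.limitArgmin P θ₀ Θ))
    -- the empirical Bayes hyper-parameter estimator
    (ηEB : ℕ → Ω → EuclideanSpace ℝ (Fin p))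
    (hη_meas : ∀ N, Measurable (ηEB N))
    (hη_mem : ∀ N, ∀ᵐ ω ∂μ, ηEB N ω ∈ Θ)
    (hη_min : ∀ᵐ ω ∂μ, ∀ᶠ N : ℕ in atTop,
      IsMinOn
        (fun η => RegFIR.ebCost
          (RegFIR.regMatrix (fun t => RegFIR.input h e t ω) n N)
          (RegFIR.output (fun t => RegFIR.input h e t ω) (fun t => v t ω) θ₀ N)
          (P η))
        Θ (ηEB N ω))
    (hη_interior : ∀ᵐ ω ∂μ, ∀ᶠ N : ℕ in atTop, ηEB N ω ∈ interior Θ) :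
    -- the regularized estimator
    TendstoInDistribution
      (fun (N : ℕ) ω => Real.sqrt (N : ℝ) •
        (RegFIR.rlsEstimator
          (RegFIR.regMatrix (fun t => RegFIR.input h e t ω) n N)
          (RegFIR.output (fun t => RegFIR.input h e t ω) (fun t => v t ω) θ₀ N)
          (P (ηEB N ω)) - θ₀))
      atTop id (fun _ => μ)
      (multivariateGaussian 0 (σ ^ 2 • (RegFIR.inputCov μ (RegFIR.input h e) n)⁻¹)) ∧
    -- the least squares estimator, with the same limit
    TendstoInDistribution
      (fun (N : ℕ) ω => Real.sqrt (N : ℝ) •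
        (RegFIR.lsEstimator
          (RegFIR.regMatrix (fun t => RegFIR.input h e t ω) n N)
          (RegFIR.output (fun t => RegFIR.input h e t ω) (fun t => v t ω) θ₀ N) - θ₀))
      atTop id (fun _ => μ)
      (multivariateGaussian 0 (σ ^ 2 • (RegFIR.inputCov μ (RegFIR.input h e) n)⁻¹)) := by
  have hw : RegFIR.IsWhiteNoise (fun t : ℕ => v (t + 1)) μ (σ ^ 2) _ :=
    RegFIR.isWhiteNoise_of_identDistrib hv_meas hv_indep hv_ident hv_mean hv_var hv_mom 0
  have he : RegFIR.IsWhiteNoise e μ (σe ^ 2) _ :=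
    RegFIR.isWhiteNoise_of_identDistrib he_meas he_indep he_ident he_mean he_var he_mom 0
  simp_rw [RegFIR.output_eq]
  exact ⟨he.tendstoInDistribution_rlsEstimator h_stable hw hv_ident hev hσ h_cov θ₀ hΘ hP_pos
      (fun i j => (hP_smooth i j).continuousOn) hη_meas hη_mem,
    he.tendstoInDistribution_lsEstimator h_stable hw hv_ident hev h_cov θ₀⟩
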